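/- **Setting.** Let $n\in\mathbb N$, $\hbar>0$, and let $V:\hbar\mathbb Z^n\to[0,\infty)$ satisfy $V(k)\to\infty$ as $|k|\to\infty$. Let $\mathcal H=\mathcal H_{\hbar,V}$ be the discrete Schrödinger operator $$\mathcal Hu(k)=-\hbar^{-2}\Big(\sum_{j=1}^n\big(u(k+\hbar v_j)+u(k-\hbar v_j)\big)-2n\,u(k)\Big)+V(k)u(k),\qquad k\in\hbar\mathbb Z^n ,$$ where $v_j$ are the unit vectors. It has an orthonormal basis $(u_\xi)$ of $\ell^2(\hbar\mathbb Z^n)$ of eigenfunctions, with eigenvalues $\lambda_\xi\ge0$. Let $\mathrm H^\infty$ be the space of all $\varphi$ with $(I+\mathcal H)^j\varphi\in\ell^2(\hbar\mathbb Z^n)$ for all $j\ge 0$, with the corresponding Fréchet topology, and $\mathrm H^{-\infty}$ the space of its continuous (conjugate-linear) functionals. For $s\in\mathbb R$ let $\mathrm H^s_{\mathcal H}$ be the space of those $w\in \mathrm H^{-\infty}$ with $\|w\|_{\mathrm H^s_{\mathcal H}}^2=\|(I+\mathcal H)^{s/2}w\|_{\ell^2}^2=\sum_\xi(1+\lambda_\xi)^s|(w,u_\xi)|^2<\infty$.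 For $T>0$ consider the Cauchy problem $$\partial_t^2u+a(t)\mathcal Hu+q(t)u=f\ \text{ on } (0,T]\times\hbar\mathbb Z^n,\qquad u(0)=u_0,\quad \partial_tu(0)=u_1, \tag{1}$$ with real $a,q$. Solutions are understood in the sense of $\mathrm H^{-\infty}$: for every $\varphi\in \mathrm H^\infty$ the function $t\mapsto (u(t),\varphi)$ is differentiable on $[0,T]$ with absolutely continuous derivative, and the equation tested with $\varphi$ holds for a.e. $t$. A *classical solution* is a solution in $C([0,T];\mathrm H^{1+s}_{\mathcal H})\cap C^1([0,T];\mathrm H^{s}_{\mathcal H})$. **Regularising families.** A Friedrichs mollifier is $\psi\in C_0^\infty(\mathbb R)$ with $\psi\ge0$, $\int\psi=1$; put $\psi_r(t)=r^{-1}\psi(t/r)$. Let $\omega:(0,1]\to(0,\infty)$ with $\omega(\varepsilon)\to0$ as $\varepsilon\to0$. The functions $a$, $q$, $f$ on $[0,T]$ are extended to $A,Q\in L^\infty(\mathbb R)$ and $F\in L^2(\mathbb R;\mathrm H^s_{\mathcal H})$, and regularising families are the nets $$a_\varepsilon=A*\psi_{\omega(\varepsilon)},\qquad q_\varepsilon=Q*\psi_{\omega(\varepsilon)},\qquad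 f_\varepsilon=F*\psi_{\omega(\varepsilon)}\ (\text{convolution in } t),\qquad \varepsilon\in(0,1],$$ (the mollifier and the scale $\omega$ may differ for $a$, $q$, $f$), provided that they are moderate: for each compact $K\subset\mathbb R$ there are $N\in\mathbb N_0$, $c>0$ with $\|\partial^ka_\varepsilon\|_{L^\infty(K)}\le c\,\varepsilon^{-N-k}$ for $k=0,1$ (respectively $\|q_\varepsilon\|_{L^\infty(K)}\le c\,\varepsilon^{-N}$) for all $\varepsilon\in(0,1]$, and there are $N,c$ with $\|f_\varepsilon\|_{L^2([0,T];\mathrm H^s_{\mathcal H})}\le c\,\varepsilon^{-N}$ for all $\varepsilon\in(0,1]$. For $a$ the strict positivity has to be preserved: $A\ge0$ a.e., and either $A\ge\alpha$ a.e. on a neighbourhood of $[0,T]$ for some constant $\alpha>0$, or the values of $A$ outside $[0,T]$ are not restricted further (for example $A=0$ there) and the mollifier used for $a$ takes positive values both at some point of $(-\infty,0)$ and at some point of $(0,\infty)$. A net $(u_\varepsilon)_{\varepsilon\in(0,1]}$ in $L^2([0,T];\mathrm H^{1+s}_{\mathcal H})$ is a *very weak solution of order $s$* of (1) associated with $a_\varepsilon,q_\varepsilon,f_\varepsilon$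 if, for every $\varepsilon\in(0,1]$, $u_\varepsilon$ solves (1) with $a,q,f$ replaced by $a_\varepsilon,q_\varepsilon,f_\varepsilon$ and the same data $u_0,u_1$, and if there are $N\in\mathbb N_0$, $c>0$ with $\|u_\varepsilon\|_{L^2([0,T];\mathrm H^{1+s}_{\mathcal H})}\le c\,\varepsilon^{-N}$ for all $\varepsilon\in(0,1]$. **Theorem (Consistency).** Let $s\in\mathbb R$ and $f\in L^2([0,T];\mathrm H^s_{\mathcal H})$. Assume that $a\in L^\infty_1([0,T])$ (that is, $a$ is bounded with bounded derivative, or more generally Lipschitz, on $[0,T]$) satisfies $a(t)\ge a_0>0$ on $[0,T]$, that $q\in L^\infty([0,T])$, and that $(u_0,u_1)\in \mathrm H^{1+s}_{\mathcal H}\times \mathrm H^{s}_{\mathcal H}$. Let $u$ be the classical solution of (1). Then for any regularising families $a_\varepsilon,q_\varepsilon,f_\varepsilon$ as above, the associated very weak solution $(u_\varepsilon)_\varepsilon$ converges to $u$: $$\|u_\varepsilon-u\|_{L^2([0,T];\mathrm H^{1+s}_{\mathcal H})}\longrightarrow0\qquad\text{as }\varepsilon\to0 .$$ -/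

import Mathlib

open MeasureTheory Filter Set
open scoped ENNReal Topology

noncomputable section

/-- The Hilbert space `ℓ²(X)`. -/
abbrev EllTwo (X : Type) := lp (fun _ : X => ℂ) 2

namespace EllTwo

variable {X : Type}

theorem memlp_bdd_mul (r : X → ℝ) (C : ℝ) (hr : ∀ k, |r k| ≤ C) (f : EllTwo X) :
    Memℓp (fun k => (r k : ℂ) * f k) 2 := by
  refine Memℓp.mono' (lp.memℓp ((C : ℂ) • f)) fun k => ?_
  have hC : 0 ≤ C := (abs_nonneg _).trans (hr k)
  simp only [lp.coeFn_smul, Pi.smul_apply, smul_eq_mul, norm_mul, Complex.norm_real,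
    Real.norm_eq_abs, abs_of_nonneg hC]
  exact mul_le_mul_of_nonneg_right (hr k) (norm_nonneg _)

/-- Multiplication by a bounded real function, as a bounded operator on `ℓ²(X)`. -/
def diag (r : X → ℝ) (C : ℝ) (hr : ∀ k, |r k| ≤ C) : EllTwo X →L[ℂ] EllTwo X :=
  LinearMap.mkContinuous
    { toFun := fun f => (⟨fun k => (r k : ℂ) * f k, memlp_bdd_mul r C hr f⟩ : EllTwo X)
      map_add' := fun f g => by
        ext k; exact mul_add (r k : ℂ) (f k) (g k)
      map_smul' := fun c f => by
        ext k; exact mul_left_comm (r k : ℂ) c (f k) } |C| (fun f => by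
    have h : ‖f‖ * |C| = ‖((|C| : ℝ) : ℂ) • f‖ := by rw [norm_smul]; simp [mul_comm]
    rw [mul_comm, h]
    refine lp.norm_mono (by norm_num) fun k => ?_
    simp only [LinearMap.coe_mk, AddHom.coe_mk, lp.coeFn_smul, Pi.smul_apply, smul_eq_mul,
      norm_mul, Complex.norm_real, Real.norm_eq_abs, abs_abs]
    exact mul_le_mul_of_nonneg_right ((hr k).trans (le_abs_self C)) (norm_nonneg _))

theorem diag_apply (r : X → ℝ) (C : ℝ) (hr : ∀ k, |r k| ≤ C) (f : EllTwo X) (k : X) :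
    diag r C hr f k = (r k : ℂ) * f k := rfl

theorem norm_diag_le (r : X → ℝ) (C : ℝ) (hC : 0 ≤ C) (hr : ∀ k, |r k| ≤ C) :
    ‖diag r C hr‖ ≤ C := by
  exact (LinearMap.mkContinuous_norm_le _ (abs_nonneg C) _).trans (abs_of_nonneg hC).le

theorem diag_symm (r : X → ℝ) (C : ℝ) (hr : ∀ k, |r k| ≤ C) (f g : EllTwo X) :
    inner ℂ (diag r C hr f) g = inner ℂ f (diag r C hr g) := by
  simp only [lp.inner_eq_tsum, diag_apply]
  refine tsum_congr fun k => ?_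
  simp [mul_left_comm, mul_assoc]

theorem diag_compact (r : X → ℝ) (C : ℝ) (hr : ∀ k, |r k| ≤ C)
    (h0 : Tendsto r cofinite (𝓝 0)) : IsCompactOperator (diag r C hr) := by
  classical
  let F : Finset X → (EllTwo X →L[ℂ] EllTwo X) := fun s =>
    ∑ k ∈ s, (r k : ℂ) • ((lp.singleContinuousLinearMap ℂ (fun _ : X => ℂ) 2 k).comp
      (lp.evalCLM ℂ (fun _ : X => ℂ) 2 k))
  have hFapp : ∀ s f k, F s f k = if k ∈ s then (r k : ℂ) * f k else 0 := by
    intro s f k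
    have hsum : (lp.evalCLM ℂ (fun _ : X => ℂ) 2 k) (F s f) = ∑ j ∈ s,
        (lp.evalCLM ℂ (fun _ : X => ℂ) 2 k) (((r j : ℂ) •
          ((lp.singleContinuousLinearMap ℂ (fun _ : X => ℂ) 2 j).comp
            (lp.evalCLM ℂ (fun _ : X => ℂ) 2 j))) f) := by
      rw [← map_sum]
      congr 1
      exact _root_.sum_apply _ _ _
    refine Eq.trans hsum ?_
    have hj : ∀ j, (lp.evalCLM ℂ (fun _ : X => ℂ) 2 k) (((r j : ℂ) •
        ((lp.singleContinuousLinearMap ℂ (fun _ : X => ℂ) 2 j).comp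
          (lp.evalCLM ℂ (fun _ : X => ℂ) 2 j))) f) =
        if k = j then (r j : ℂ) * f j else 0 := fun j => by
      show (r j : ℂ) * (lp.single 2 j (f j) : EllTwo X) k = _
      rw [lp.single_apply, Pi.single_apply]
      split_ifs with h <;> simp
    simp only [hj]
    simp
  refine isCompactOperator_of_tendsto (l := atTop) (F := F) ?_ (Eventually.of_forall fun s => ?_)
  · rw [Metric.tendsto_atTop]
    intro ε hε
    have hfin : {k | ¬ |r k| < ε / 2}.Finite := by
      have := (Metric.tendsto_nhds.1 h0) (ε / 2) (by positivity)
      simpa [eventually_cofinite, Real.dist_eq] using this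
    refine ⟨hfin.toFinset, fun s hs => ?_⟩
    rw [dist_eq_norm]
    refine lt_of_le_of_lt (ContinuousLinearMap.opNorm_le_bound _ (by positivity : 0 ≤ ε / 2)
      fun f => ?_) (half_lt_self hε)
    have h : ε / 2 * ‖f‖ = ‖((ε / 2 : ℝ) : ℂ) • f‖ := by
      rw [norm_smul, Complex.norm_real, Real.norm_eq_abs, abs_of_pos (by positivity)]
    rw [h]
    refine lp.norm_mono (by norm_num) fun k => ?_
    rw [_root_.sub_apply, lp.coeFn_sub, Pi.sub_apply, hFapp, diag_apply,
      lp.coeFn_smul, Pi.smul_apply, smul_eq_mul, norm_mul, Complex.norm_real, Real.norm_eq_abs,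
      abs_of_pos (show 0 < ε / 2 by positivity)]
    by_cases hk : k ∈ s
    · simp only [hk, if_true, sub_self, norm_zero]; positivity
    · have : |r k| < ε / 2 := by
        by_contra hcon
        exact hk (hs (by simpa using hcon))
      simp only [hk, if_false, zero_sub, norm_neg, norm_mul, Complex.norm_real, Real.norm_eq_abs]
      exact mul_le_mul_of_nonneg_right this.le (norm_nonneg _)
  · simp only [F]
    induction s using Finset.induction_on with
    | empty => simpa using isCompactOperator_zero
    | insert a s ha ih =>
      rw [Finset.sum_insert ha]
      refine IsCompactOperator.add ?_ ih
      refine IsCompactOperator.smul ?_ _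
      exact (isCompactOperator_of_locallyCompactSpace_dom
        (lp.evalCLM ℂ (fun _ : X => ℂ) 2 a)).clm_comp
          (lp.singleContinuousLinearMap ℂ (fun _ : X => ℂ) 2 a)

theorem memlp_comp (e : X ≃ X) (f : EllTwo X) : Memℓp (fun k => f (e k)) 2 := by
  have h := (memℓp_gen_iff (by norm_num)).1 (lp.memℓp f)
  exact (memℓp_gen_iff (by norm_num)).2 ((e.summable_iff (f := fun k => ‖f k‖ ^ (2 : ℝ≥0∞).toReal)).2 h)

/-- Composition with a bijection, as a bounded operator on `ℓ²(X)`. -/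
def shift (e : X ≃ X) : EllTwo X →L[ℂ] EllTwo X :=
  LinearMap.mkContinuous
    { toFun := fun f => (⟨fun k => f (e k), memlp_comp e f⟩ : EllTwo X)
      map_add' := fun f g => by ext k; rfl
      map_smul' := fun c f => by ext k; rfl } 1 (fun f => by
    rw [one_mul]
    refine lp.norm_le_of_tsum_le (by norm_num) (norm_nonneg _) ?_
    rw [lp.norm_rpow_eq_tsum (by norm_num) f]
    exact (e.tsum_eq (fun k => ‖f k‖ ^ (2 : ℝ≥0∞).toReal)).le)

theorem shift_apply (e : X ≃ X) (f : EllTwo X) (k : X) : shift e f k = f (e k) := rfl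

theorem norm_shift_le (e : X ≃ X) : ‖shift e‖ ≤ 1 :=
  LinearMap.mkContinuous_norm_le _ zero_le_one _

theorem shift_adj (e : X ≃ X) (f g : EllTwo X) :
    inner ℂ (shift e f) g = inner ℂ f (shift e.symm g) := by
  simp only [lp.inner_eq_tsum, shift_apply]
  rw [← e.tsum_eq (fun k => inner ℂ (f k) (g (e.symm k)))]
  simp

theorem exists_hilbertBasis_eigen {H : Type} [NormedAddCommGroup H] [InnerProductSpace ℂ H]
    [CompleteSpace H] (R : H →L[ℂ] H) (hRc : IsCompactOperator R)
    (hRs : (R : H →ₗ[ℂ] H).IsSymmetric) :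
    ∃ (ι : Type) (b : HilbertBasis ι ℂ H) (μ : ι → ℂ), ∀ i, R (b i) = μ i • b i := by
  have hbot := ContinuousLinearMap.orthogonalComplement_iSup_eigenspaces_eq_bot hRc hRs
  let Es : ℂ → Submodule ℂ (H) := fun μ => Module.End.eigenspace (R : Module.End ℂ (H)) μ
  have hclosed : ∀ μ, IsClosed (Es μ : Set (H)) := fun μ => by
    have : (Es μ : Set (H)) = {f | R f = μ • f} := by
      ext f; exact Module.End.mem_eigenspace_iff
    rw [this]
    exact isClosed_eq R.continuous (continuous_const_smul μ)
  have : ∀ μ, CompleteSpace (Es μ) := fun μ => (hclosed μ).completeSpace_coe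
  have hex : ∀ μ, ∃ (w : Set (Es μ)) (b : HilbertBasis w ℂ (Es μ)), ⇑b = ((↑) : w → Es μ) :=
    fun μ => exists_hilbertBasis ℂ (Es μ)
  choose w bw hbw using hex
  have hOF : OrthogonalFamily ℂ (fun μ => Es μ) fun μ => (Es μ).subtypeₗᵢ :=
    hRs.orthogonalFamily_eigenspaces
  have hon : Orthonormal ℂ (fun a : Σ μ, w μ => (Es a.1).subtypeₗᵢ (bw a.1 a.2)) :=
    hOF.orthonormal_sigma_orthonormal (fun μ => (bw μ).orthonormal)
  have hspan : (Submodule.span ℂ (Set.range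
      (fun a : Σ μ, w μ => (Es a.1).subtypeₗᵢ (bw a.1 a.2))))ᗮ = ⊥ := by
    rw [eq_bot_iff, ← hbot]
    intro x hx
    rw [Submodule.mem_orthogonal] at hx
    rw [← Submodule.iInf_orthogonal, Submodule.mem_iInf]
    intro μ
    rw [Submodule.mem_orthogonal]
    intro y hy
    have hz : ∀ z : Es μ, z ∈ (Submodule.span ℂ (Set.range (bw μ))).topologicalClosure →
        inner ℂ (z : H) x = 0 := by
      intro z hz
      have hcl : IsClosed {z : Es μ | inner ℂ (z : H) x = 0} :=
        isClosed_eq (by fun_prop) continuous_const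
      refine closure_minimal (fun z hz => ?_) hcl hz
      simp only [Set.mem_ofPred_eq]
      induction hz using Submodule.span_induction with
      | mem z hz =>
        obtain ⟨i, rfl⟩ := hz
        exact hx _ (Submodule.subset_span ⟨⟨μ, i⟩, rfl⟩)
      | zero => simp
      | add a b _ _ ha hb => simp [ha, hb]
      | smul a b _ hb => simp [hb]
    refine hz ⟨y, hy⟩ ?_
    rw [(bw μ).dense_span]
    trivial
  let b := HilbertBasis.mkOfOrthogonalEqBot hon hspan
  have hb : ∀ a, b a = (bw a.1 a.2 : H) := fun a => by
    simp [b, HilbertBasis.coe_mkOfOrthogonalEqBot]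
  refine ⟨_, b, fun a => a.1, fun a => ?_⟩
  rw [hb]
  exact Module.End.mem_eigenspace_iff.1 (bw a.1 a.2).2

/-- Abstract spectral step: if `D - K` (`D` a diagonal operator tending to infinity with
`1 + c ≤ D`, and `K` bounded symmetric with norm at most `c`) is considered pointwise, there is an
orthonormal basis of `ℓ²` made of its eigenfunctions, with eigenvalues at least `1`. -/
theorem exists_eigenbasis (D : X → ℝ) (c : ℝ) (hc : 0 ≤ c) (hD : ∀ k, 1 + c ≤ D k)
    (hDtop : Tendsto D cofinite atTop) (K : EllTwo X →L[ℂ] EllTwo X) (hK : ‖K‖ ≤ c)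
    (hKs : ∀ f g, inner ℂ (K f) g = inner ℂ f (K g)) :
    ∃ (ι : Type) (b : HilbertBasis ι ℂ (EllTwo X)) (ν : ι → ℝ), (∀ i, 1 ≤ ν i) ∧
      ∀ i k, (D k : ℂ) * b i k - K (b i) k = (ν i : ℂ) * b i k := by
  have hd : 0 < 1 + c := by linarith
  have hDpos : ∀ k, 0 < D k := fun k => hd.trans_le (hD k)
  set C := (Real.sqrt (1 + c))⁻¹ with hCdef
  have hC0 : 0 ≤ C := by positivity
  have hCC : C * C = (1 + c)⁻¹ := by
    rw [hCdef, ← mul_inv, Real.mul_self_sqrt hd.le]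
  let r : X → ℝ := fun k => (Real.sqrt (D k))⁻¹
  have hrr : ∀ k, r k * r k * D k = 1 := fun k => by
    have : r k * r k = (D k)⁻¹ := by
      simp only [r]; rw [← mul_inv, Real.mul_self_sqrt (hDpos k).le]
    rw [this, inv_mul_cancel₀ (hDpos k).ne']
  have hr : ∀ k, |r k| ≤ C := fun k => by
    simp only [r]
    rw [abs_of_nonneg (by positivity)]
    exact inv_anti₀ (Real.sqrt_pos.2 hd) (Real.sqrt_le_sqrt (hD k))
  have hr0 : Tendsto r cofinite (𝓝 0) :=
    tendsto_inv_atTop_zero.comp (Real.tendsto_sqrt_atTop.comp hDtop)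
  set A := diag r C hr with hA
  have hAn : ‖A‖ ≤ C := norm_diag_le r C hC0 hr
  have hAs : ∀ f g, inner ℂ (A f) g = inner ℂ f (A g) := diag_symm r C hr
  set B : EllTwo X →L[ℂ] EllTwo X := A * K * A with hB
  have hBn : ‖B‖ ≤ c / (1 + c) := by
    calc ‖B‖ ≤ ‖A‖ * ‖K‖ * ‖A‖ :=
          (norm_mul_le _ _).trans (mul_le_mul_of_nonneg_right (norm_mul_le _ _) (norm_nonneg _))
      _ ≤ C * c * C := by gcongr
      _ = c / (1 + c) := by rw [div_eq_mul_inv, ← hCC]; ring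
  have hB1 : ‖B‖ < 1 := hBn.trans_lt (by rw [div_lt_one hd]; linarith)
  have hBs : ∀ f g, inner ℂ (B f) g = inner ℂ f (B g) := fun f g => by
    show inner ℂ (A (K (A f))) g = inner ℂ f (A (K (A g)))
    rw [hAs, hKs, hAs]
  let U := Units.oneSub B hB1
  have hU : (U : EllTwo X →L[ℂ] EllTwo X) = 1 - B := rfl
  set N : EllTwo X →L[ℂ] EllTwo X := Units.val U⁻¹ with hN
  have hUN : ∀ f, N f - B (N f) = f := fun f => by
    have h : (U : EllTwo X →L[ℂ] EllTwo X) * N = 1 := U.mul_inv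
    have := congrArg (fun T : EllTwo X →L[ℂ] EllTwo X => T f) h
    simpa [hU] using this
  have hNs : ∀ f g, inner ℂ (N f) g = inner ℂ f (N g) := fun f g => by
    conv_lhs => rw [← hUN g]
    conv_rhs => rw [← hUN f]
    rw [inner_sub_left, inner_sub_right, hBs]
  let R : EllTwo X →L[ℂ] EllTwo X := A * N * A
  have hRs : (R : EllTwo X →ₗ[ℂ] EllTwo X).IsSymmetric := fun f g => by
    show inner ℂ (A (N (A f))) g = inner ℂ f (A (N (A g)))
    rw [hAs, hNs, hAs]
  have hRc : IsCompactOperator R := by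
    have h1 : IsCompactOperator A := diag_compact r C hr hr0
    exact h1.comp_clm (N * A)
  -- eigenvectors of `R`
  have key : ∀ (μ : ℂ) (φ : EllTwo X), φ ≠ 0 → R φ = μ • φ → ∃ ν : ℝ, 1 ≤ ν ∧
      ∀ k, (D k : ℂ) * φ k - K φ k = (ν : ℂ) * φ k := by
    intro μ φ hφ hμφ
    have hφ0 : 0 < ‖φ‖ := norm_pos_iff.2 hφ
    set ψ := N (A φ) with hψ
    have hψeq : ψ - B ψ = A φ := hUN _
    have hAψ : A ψ = μ • φ := hμφ
    have hne : μ ≠ 0 := by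
      intro h0
      rw [h0, zero_smul] at hAψ
      have hψ0 : ψ = 0 := by
        ext k
        have := congrArg (fun f : EllTwo X => f k) hAψ
        simp only [hA, diag_apply, lp.coeFn_zero, Pi.zero_apply, mul_eq_zero,
          Complex.ofReal_eq_zero] at this
        rcases this with h | h
        · exact absurd h (by simpa [r] using (Real.sqrt_pos.2 (hDpos k)).ne')
        · simpa using h
      rw [hψ0] at hψeq
      have hAφ : A φ = 0 := by simpa using hψeq.symm
      apply hφ
      ext k
      have := congrArg (fun f : EllTwo X => f k) hAφ
      simp only [hA, diag_apply, lp.coeFn_zero, Pi.zero_apply, mul_eq_zero,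
        Complex.ofReal_eq_zero] at this
      rcases this with h | h
      · exact absurd h (by simpa [r] using (Real.sqrt_pos.2 (hDpos k)).ne')
      · simpa using h
    have hreal : (starRingEnd ℂ) μ = μ :=
      hRs.conj_eigenvalue_eq_self (Module.End.hasEigenvalue_of_hasEigenvector
        ⟨Module.End.mem_eigenspace_iff.2 hμφ, hφ⟩)
    obtain ⟨m, rfl⟩ := Complex.conj_eq_iff_real.1 hreal
    have hm0 : m ≠ 0 := by simpa using hne
    -- positivity
    have hψn : (1 + c)⁻¹ * ‖ψ‖ ≤ ‖A φ‖ := by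
      have h1 : ‖ψ‖ ≤ ‖A φ‖ + ‖B ψ‖ := by
        have : ψ = A φ + B ψ := by rw [← hψeq]; abel
        calc ‖ψ‖ = ‖A φ + B ψ‖ := by rw [← this]
          _ ≤ _ := norm_add_le _ _
      have h2 : ‖B ψ‖ ≤ c / (1 + c) * ‖ψ‖ :=
        (B.le_opNorm ψ).trans (mul_le_mul_of_nonneg_right hBn (norm_nonneg _))
      have h3 : (1 + c)⁻¹ * ‖ψ‖ = ‖ψ‖ - c / (1 + c) * ‖ψ‖ := by field_simp; ring
      linarith
    have hmle : |m| ≤ 1 := by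
      have h1 : |m| * ‖φ‖ ≤ C * ‖ψ‖ := by
        have : ‖A ψ‖ = |m| * ‖φ‖ := by rw [hAψ, norm_smul]; simp
        rw [← this]
        exact (A.le_opNorm ψ).trans (mul_le_mul_of_nonneg_right hAn (norm_nonneg _))
      have h2 : ‖A φ‖ ≤ C * ‖φ‖ :=
        (A.le_opNorm φ).trans (mul_le_mul_of_nonneg_right hAn (norm_nonneg _))
      have h3 : ‖ψ‖ ≤ (1 + c) * (C * ‖φ‖) := by
        have := mul_le_mul_of_nonneg_left (hψn.trans h2) hd.le
        rwa [← mul_assoc, mul_inv_cancel₀ hd.ne', one_mul] at this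
      have h4 : |m| * ‖φ‖ ≤ 1 * ‖φ‖ := by
        calc |m| * ‖φ‖ ≤ C * ((1 + c) * (C * ‖φ‖)) :=
              h1.trans (mul_le_mul_of_nonneg_left h3 hC0)
          _ = (C * C) * (1 + c) * ‖φ‖ := by ring
          _ = 1 * ‖φ‖ := by rw [hCC, inv_mul_cancel₀ hd.ne']
      exact le_of_mul_le_mul_right h4 hφ0
    have hmnn : 0 ≤ m := by
      have h1 : inner ℂ (A φ) ψ = ((m * ‖φ‖ ^ 2 : ℝ) : ℂ) := by
        rw [hAs, hAψ, inner_smul_right, inner_self_eq_norm_sq_to_K]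
        simp
      have h2 : inner ℂ (A φ) ψ = ((‖ψ‖ ^ 2 : ℝ) : ℂ) - inner ℂ (B ψ) ψ := by
        rw [← hψeq, inner_sub_left, inner_self_eq_norm_sq_to_K]
        simp
      have h3 : ‖inner ℂ (B ψ) ψ‖ ≤ ‖ψ‖ ^ 2 := by
        calc ‖inner ℂ (B ψ) ψ‖ ≤ ‖B ψ‖ * ‖ψ‖ := norm_inner_le_norm _ _
          _ ≤ (1 * ‖ψ‖) * ‖ψ‖ := by
              gcongr
              exact (B.le_opNorm ψ).trans (mul_le_mul_of_nonneg_right hB1.le (norm_nonneg _))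
          _ = ‖ψ‖ ^ 2 := by ring
      have h4 : (inner ℂ (B ψ) ψ : ℂ).re ≤ ‖ψ‖ ^ 2 := (Complex.re_le_norm _).trans h3
      have h5 := congrArg Complex.re (h1.symm.trans h2)
      rw [Complex.sub_re, Complex.ofReal_re, Complex.ofReal_re] at h5
      have h6 : 0 ≤ m * ‖φ‖ ^ 2 := by rw [h5]; linarith
      exact nonneg_of_mul_nonneg_left h6 (by positivity)
    have hmpos : 0 < m := lt_of_le_of_ne hmnn hm0.symm
    refine ⟨m⁻¹, (one_le_inv₀ hmpos).2 ((le_abs_self m).trans hmle), fun k => ?_⟩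
    -- `φ = m⁻¹ A ψ`
    have hφψ : φ = ((m⁻¹ : ℝ) : ℂ) • A ψ := by
      rw [hAψ, smul_smul]
      simp [hm0]
    have hrk : (r k : ℂ) * r k * D k = 1 := by exact_mod_cast hrr k
    have hrk0 : (r k : ℂ) ≠ 0 := fun h => by simp [h] at hrk
    have h1 := congrArg (fun f : EllTwo X => f k) hψeq
    simp only [hB, hA, lp.coeFn_sub, Pi.sub_apply, diag_apply] at h1
    have h2 : φ k = ((m⁻¹ : ℝ) : ℂ) * ((r k : ℂ) * ψ k) := by
      have := congrArg (fun f : EllTwo X => f k) hφψ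
      simpa only [lp.coeFn_smul, Pi.smul_apply, smul_eq_mul, hA, diag_apply] using this
    have h3 : K φ k = ((m⁻¹ : ℝ) : ℂ) * K (A ψ) k := by
      conv_lhs => rw [hφψ]
      rw [map_smul, lp.coeFn_smul, Pi.smul_apply, smul_eq_mul]
    have h4 : (D k : ℂ) * (r k * ψ k) - K (A ψ) k = φ k := by
      apply mul_left_cancel₀ hrk0
      rw [← h1, mul_sub]
      congr 1
      calc (r k : ℂ) * (D k * (r k * ψ k)) = (r k * r k * D k) * ψ k := by ring
        _ = ψ k := by rw [hrk, one_mul]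
    rw [h3]
    conv_lhs => rw [h2]
    conv_rhs => rw [← h4]
    ring
  obtain ⟨ι, b, μ, hb⟩ := exists_hilbertBasis_eigen R hRc hRs
  have hk : ∀ i, ∃ ν : ℝ, 1 ≤ ν ∧ ∀ k, (D k : ℂ) * b i k - K (b i) k = (ν : ℂ) * b i k :=
    fun i => key (μ i) (b i) (b.orthonormal.ne_zero i) (hb i)
  choose ν hν1 hν2 using hk
  exact ⟨ι, b, ν, hν1, hν2⟩

end EllTwo

/-- The lattice `hℤⁿ = {x ∈ ℝⁿ : x = h k, k ∈ ℤⁿ}`. -/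
def hLattice (n : ℕ) (h : ℝ) : AddSubgroup (EuclideanSpace ℝ (Fin n)) where
  carrier := {x | ∃ k : Fin n → ℤ, ∀ i, x i = h * k i}
  zero_mem' := ⟨0, fun i => by simp⟩
  add_mem' := by
    rintro x y ⟨k, hk⟩ ⟨l, hl⟩
    exact ⟨k + l, fun i => by simp [hk, hl, mul_add]⟩
  neg_mem' := by
    rintro x ⟨k, hk⟩
    exact ⟨-k, fun i => by simp [hk]⟩

/-- The lattice vector `h vⱼ`, where `vⱼ` is the `j`-th unit vector. -/
def hLattice.step {n : ℕ} {h : ℝ} (j : Fin n) : hLattice n h :=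
  ⟨EuclideanSpace.single j h, ⟨Pi.single j 1, fun i => by
    by_cases hij : i = j
    · subst hij; simp
    · simp [hij]⟩⟩

/-- The parameter `h > 0` and a potential `V ≥ 0` on `hℤⁿ` with `|V(k)| → ∞` as `|k| → ∞`. -/
structure DiscreteSchrodinger (n : ℕ) where
  h : ℝ
  h_pos : 0 < h
  V : hLattice n h → ℝ
  V_nonneg : ∀ k, 0 ≤ V k
  V_tendsto : Tendsto (fun k => |V k|)
    (comap (fun k : hLattice n h => ‖(k : EuclideanSpace ℝ (Fin n))‖) atTop) atTop

namespace DiscreteSchrodinger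

variable {n : ℕ} (S : DiscreteSchrodinger n)

/-- The points of the lattice `hℤⁿ`. -/
abbrev Pt : Type := hLattice n S.h

/-- The discrete Laplacian
`L u (k) = ∑ⱼ (u (k + h vⱼ) + u (k - h vⱼ)) - 2 n u (k)`. -/
def laplacian : (S.Pt → ℂ) →ₗ[ℂ] (S.Pt → ℂ) where
  toFun u k := (∑ j : Fin n, (u (k + hLattice.step j) + u (k - hLattice.step j))) - 2 * n * u k
  map_add' u v := by
    ext k
    simp only [Pi.add_apply, Finset.sum_add_distrib]
    ring
  map_smul' c u := by
    ext k
    simp only [Pi.smul_apply, smul_eq_mul, RingHom.id_apply, Finset.sum_add_distrib, mul_sub,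
      mul_add, Finset.mul_sum]
    ring

/-- The discrete Schrödinger operator `H u = (-h⁻² L + V) u`, acting on functions on `hℤⁿ`. -/
def ham : (S.Pt → ℂ) →ₗ[ℂ] (S.Pt → ℂ) where
  toFun u k := -((S.h : ℂ) ^ 2)⁻¹ * S.laplacian u k + (S.V k : ℂ) * u k
  map_add' u v := by
    ext k
    simp only [map_add, Pi.add_apply]
    ring
  map_smul' c u := by
    ext k
    simp only [map_smul, Pi.smul_apply, smul_eq_mul, RingHom.id_apply]
    ring

/-- The operator `I + H`. -/
def onePlusHam : (S.Pt → ℂ) →ₗ[ℂ] (S.Pt → ℂ) := LinearMap.id + S.ham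

/-! ### Eigenfunction basis -/

theorem tendsto_norm_cofinite :
    Tendsto (fun k : S.Pt => ‖(k : EuclideanSpace ℝ (Fin n))‖) cofinite atTop := by
  rw [tendsto_atTop]
  intro R
  rw [eventually_cofinite]
  obtain ⟨N, hN⟩ := exists_nat_ge (R / S.h)
  have hfin : ((fun k : Fin n → ℤ => (fun i => S.h * (k i : ℝ) : Fin n → ℝ)) ''
      (Set.Icc (fun _ => -(N : ℤ)) (fun _ => (N : ℤ)))).Finite := (Set.finite_Icc _ _).image _
  refine Set.Finite.of_finite_image (f := fun k : S.Pt => (fun i => (k : EuclideanSpace ℝ (Fin n)) i))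
    (hfin.subset ?_) ?_
  · rintro _ ⟨⟨x, k, hk⟩, hx, rfl⟩
    have hx' : ‖x‖ < R := not_le.1 hx
    have hb : ∀ i, |(k i : ℝ)| ≤ N := fun i => by
      have h1 : |x i| ≤ ‖x‖ := by simpa using PiLp.norm_apply_le x i
      rw [hk i, abs_mul, abs_of_pos S.h_pos] at h1
      have h2 : |(k i : ℝ)| ≤ R / S.h := by
        rw [le_div_iff₀ S.h_pos, mul_comm]
        exact h1.trans hx'.le
      exact h2.trans hN
    refine ⟨k, ⟨fun i => ?_, fun i => ?_⟩, ?_⟩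
    · have := (abs_le.1 (hb i)).1
      exact_mod_cast this
    · have := (abs_le.1 (hb i)).2
      exact_mod_cast this
    · funext i
      exact (hk i).symm
  · intro x _ y _ hxy
    apply Subtype.ext
    ext i
    exact congrFun hxy i

/-- An orthonormal basis of `ℓ²(hℤⁿ)` consisting of eigenfunctions `u_ξ` of `H`, with
eigenvalues `λ_ξ ≥ 0`. -/
structure EigenBasis where
  ι : Type
  basis : HilbertBasis ι ℂ (EllTwo S.Pt)
  eig : ι → ℝ
  eig_nonneg : ∀ ξ, 0 ≤ eig ξ
  eigen : ∀ ξ, S.ham (basis ξ) = (eig ξ : ℂ) • ⇑(basis ξ)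

/-- `H` has a purely discrete spectrum. -/
theorem nonempty_eigenBasis : Nonempty S.EigenBasis := by
  have hh : 0 < S.h ^ 2 := pow_pos S.h_pos 2
  let c : ℝ := (S.h ^ 2)⁻¹ * (2 * n)
  have hc : 0 ≤ c := by positivity
  let D : S.Pt → ℝ := fun k => 1 + c + S.V k
  let K : EllTwo S.Pt →L[ℂ] EllTwo S.Pt := (((S.h ^ 2)⁻¹ : ℝ) : ℂ) •
    ∑ j : Fin n, (EllTwo.shift (Equiv.addRight (hLattice.step j : S.Pt)) +
      EllTwo.shift (Equiv.addRight (hLattice.step j : S.Pt)).symm)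
  have hDtop : Tendsto D cofinite atTop := by
    refine tendsto_atTop_add_const_left _ _ ?_
    have h1 : Tendsto (fun k => |S.V k|) cofinite atTop :=
      S.V_tendsto.mono_left (tendsto_iff_comap.1 S.tendsto_norm_cofinite)
    exact h1.congr fun k => abs_of_nonneg (S.V_nonneg k)
  have hK : ‖K‖ ≤ c := by
    simp only [K, norm_smul, Complex.norm_real, Real.norm_eq_abs, abs_of_pos (inv_pos.2 hh), c]
    refine mul_le_mul_of_nonneg_left ?_ (inv_pos.2 hh).le
    refine (norm_sum_le _ _).trans ?_
    have : ∀ j ∈ (Finset.univ : Finset (Fin n)),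
        ‖EllTwo.shift (Equiv.addRight (hLattice.step j : S.Pt)) +
          EllTwo.shift (Equiv.addRight (hLattice.step j : S.Pt)).symm‖ ≤ 2 := fun j _ => by
      refine (norm_add_le _ _).trans ?_
      have h1 := EllTwo.norm_shift_le (Equiv.addRight (hLattice.step j : S.Pt))
      have h2 := EllTwo.norm_shift_le (Equiv.addRight (hLattice.step j : S.Pt)).symm
      linarith
    refine (Finset.sum_le_sum this).trans ?_
    simp [mul_comm]
  have hKapp : ∀ f, K f = (((S.h ^ 2)⁻¹ : ℝ) : ℂ) • ∑ j : Fin n,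
      (EllTwo.shift (Equiv.addRight (hLattice.step j : S.Pt)) f +
      EllTwo.shift (Equiv.addRight (hLattice.step j : S.Pt)).symm f) := fun f => by
    simp only [K, _root_.smul_apply, _root_.sum_apply, _root_.add_apply]
  have hKs : ∀ f g, inner ℂ (K f) g = inner ℂ f (K g) := fun f g => by
    rw [hKapp, hKapp, inner_smul_left, inner_smul_right, sum_inner, inner_sum]
    simp only [Complex.conj_ofReal]
    congr 1
    refine Finset.sum_congr rfl fun j _ => ?_
    rw [inner_add_left, inner_add_right, EllTwo.shift_adj, EllTwo.shift_adj, Equiv.symm_symm,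
      add_comm]
  obtain ⟨ι, b, ν, hν, hb⟩ := EllTwo.exists_eigenbasis D c hc
    (fun k => by simp only [D]; linarith [S.V_nonneg k]) hDtop K hK hKs
  refine ⟨⟨ι, b, fun i => ν i - 1, fun i => by linarith [hν i], fun i => ?_⟩⟩
  funext k
  have h1 := hb i k
  have h2 : K (b i) k = (((S.h ^ 2)⁻¹ : ℝ) : ℂ) * ∑ j : Fin n,
      (b i (k + hLattice.step j) + b i (k - hLattice.step j)) := by
    rw [hKapp, lp.coeFn_smul, Pi.smul_apply, smul_eq_mul, lp.coeFn_sum, Finset.sum_apply]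
    rfl
  rw [h2] at h1
  simp only [ham, laplacian, LinearMap.coe_mk, AddHom.coe_mk, Pi.smul_apply, smul_eq_mul]
  simp only [D, c] at h1
  push_cast at h1 ⊢
  linear_combination h1

/-- The eigenfunctions `u_ξ` and eigenvalues `λ_ξ` of `H` (a fixed choice). -/
def eigenBasis : S.EigenBasis := Classical.choice S.nonempty_eigenBasis

/-- The index set of the eigenfunctions. -/
abbrev Freq : Type := S.eigenBasis.ι

/-- The eigenvalue `λ_ξ`. -/
def eig (ξ : S.Freq) : ℝ := S.eigenBasis.eig ξ

/-! ### Test functions, distributions and Sobolev norms -/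

/-- The space of test functions `H^∞ = ⋂ₖ Dom (H^k)`: all `(I + H)^j φ` lie in `ℓ²(hℤⁿ)`. -/
def Test : Submodule ℂ (S.Pt → ℂ) where
  carrier := {φ | ∀ j : ℕ, Memℓp ((S.onePlusHam ^ j) φ) 2}
  zero_mem' j := by simpa using zero_memℓp
  add_mem' hφ hψ j := by simpa using (hφ j).add (hψ j)
  smul_mem' c φ hφ j := by simpa using (hφ j).const_smul c

/-- The norm `‖(I + H)^j φ‖` in `ℓ²(hℤⁿ)`, of a test function `φ`. -/
def testNorm (j : ℕ) (φ : S.Test) : ℝ :=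
  ‖(⟨(S.onePlusHam ^ j) φ, φ.2 j⟩ : EllTwo S.Pt)‖

/-- `H` maps test functions to test functions. -/
def hamTest : S.Test →ₗ[ℂ] S.Test :=
  S.ham.restrict fun φ hφ j => by
    have h1 : S.ham φ = S.onePlusHam φ - φ := by simp [onePlusHam]
    have h2 : (S.onePlusHam ^ j) (S.onePlusHam φ) = (S.onePlusHam ^ (j + 1)) φ := by
      rw [pow_succ, Module.End.mul_apply]
    rw [h1, map_sub, h2]
    exact (hφ (j + 1)).sub (hφ j)

/-- The eigenfunction `u_ξ`, as a test function. -/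
def eigTest (ξ : S.Freq) : S.Test :=
  ⟨S.eigenBasis.basis ξ, fun j => by
    have h : ∀ j : ℕ, (S.onePlusHam ^ j) (S.eigenBasis.basis ξ) =
        ((1 + S.eigenBasis.eig ξ : ℂ) ^ j) • ⇑(S.eigenBasis.basis ξ) := by
      intro j
      induction j with
      | zero => simp
      | succ j ih =>
        rw [pow_succ', Module.End.mul_apply, ih, map_smul]
        simp only [onePlusHam, LinearMap.add_apply, LinearMap.id_apply, S.eigenBasis.eigen ξ]
        rw [pow_succ, mul_smul, add_smul, one_smul]
    rw [h j]
    exact (lp.memℓp (S.eigenBasis.basis ξ)).const_smul _⟩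

/-- The space `H^{-∞}` of `H`-distributions: the continuous functionals `w` on the Fréchet space
`H^∞`. As in the pairing `(w, φ) = ∑ₖ w(k) conj φ(k)`, they are conjugate-linear in `φ`. Continuity
means that `|w(φ)|` is bounded by a multiple of finitely many of the norms. -/
def Distr : Submodule ℂ (S.Test →ₛₗ[starRingEnd ℂ] ℂ) where
  carrier := {w | ∃ (C : ℝ) (m : ℕ), 0 ≤ C ∧
    ∀ φ, ‖w φ‖ ≤ C * ∑ j ∈ Finset.range (m + 1), S.testNorm j φ}
  zero_mem' := ⟨0, 0, le_rfl, fun φ => by simp⟩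
  add_mem' := by
    rintro v w ⟨C, m, hC, h⟩ ⟨C', m', hC', h'⟩
    refine ⟨C + C', max m m', add_nonneg hC hC', fun φ => ?_⟩
    have hmono : ∀ a : ℕ, a ≤ max m m' → ∑ j ∈ Finset.range (a + 1), S.testNorm j φ ≤
        ∑ j ∈ Finset.range (max m m' + 1), S.testNorm j φ := fun a ha =>
      Finset.sum_le_sum_of_subset_of_nonneg (Finset.range_mono (by omega))
        (fun j _ _ => norm_nonneg _)
    rw [LinearMap.add_apply, add_mul]
    refine (norm_add_le _ _).trans (add_le_add ?_ ?_)
    · exact (h φ).trans (mul_le_mul_of_nonneg_left (hmono m (le_max_left _ _)) hC)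
    · exact (h' φ).trans (mul_le_mul_of_nonneg_left (hmono m' (le_max_right _ _)) hC')
  smul_mem' := by
    rintro c w ⟨C, m, hC, h⟩
    refine ⟨‖c‖ * C, m, mul_nonneg (norm_nonneg c) hC, fun φ => ?_⟩
    rw [LinearMap.smul_apply, norm_smul, mul_assoc]
    exact mul_le_mul_of_nonneg_left (h φ) (norm_nonneg c)

/-- The pairing `(w, φ)`. -/
def pair (w : S.Distr) (φ : S.Test) : ℂ := (w : S.Test →ₛₗ[starRingEnd ℂ] ℂ) φ

/-- The Fourier coefficient `ŵ(ξ) = (w, u_ξ)`. -/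
def coeff (w : S.Distr) (ξ : S.Freq) : ℂ := S.pair w (S.eigTest ξ)

/-- The norm `‖w‖_{H^s} = ‖(I + H)^{s/2} w‖_{ℓ²} = (∑_ξ (1 + λ_ξ)^s |ŵ(ξ)|²)^{1/2}`, with the value
`∞` when `w` is not in the Sobolev space `H^s`. -/
def sobNorm (s : ℝ) (w : S.Distr) : ℝ≥0∞ :=
  (∑' ξ, ENNReal.ofReal ((1 + S.eig ξ) ^ s * ‖S.coeff w ξ‖ ^ 2)) ^ (1 / 2 : ℝ)

/-- Membership in the Sobolev space `H^s`. -/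
def MemSob (s : ℝ) (w : S.Distr) : Prop := S.sobNorm s w < ∞

/-- The norm of `L²(J; H^s)`. -/
def l2SobNorm (J : Set ℝ) (s : ℝ) (f : ℝ → S.Distr) : ℝ≥0∞ :=
  (∫⁻ t in J, S.sobNorm s (f t) ^ (2 : ℝ)) ^ (1 / 2 : ℝ)

/-- `f ∈ L²(J; H^s)`. Measurability into the separable Hilbert space `H^s` is measurability of all
Fourier coefficients. -/
def MemL2Sob (J : Set ℝ) (s : ℝ) (f : ℝ → S.Distr) : Prop :=
  (∀ ξ, AEStronglyMeasurable (fun t => S.coeff (f t) ξ) (volume.restrict J)) ∧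
    S.l2SobNorm J s f < ∞

/-- `u ∈ C([0,T]; H^s)`. -/
def ContSob (T s : ℝ) (u : ℝ → S.Distr) : Prop :=
  ∀ t ∈ Icc 0 T, S.MemSob s (u t) ∧
    Tendsto (fun τ => S.sobNorm s (u τ - u t)) (𝓝[Icc 0 T] t) (𝓝 0)

/-- `u'` is the derivative of `u` on `[0,T]` with respect to the norm of `H^s`. -/
def HasSobDeriv (T s : ℝ) (u u' : ℝ → S.Distr) : Prop :=
  ∀ t ∈ Icc 0 T, Tendsto (fun τ => S.sobNorm s (((τ - t : ℝ) : ℂ)⁻¹ • (u τ - u t) - u' t))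
    (𝓝[Icc 0 T \ {t}] t) (𝓝 0)

/-! ### The Cauchy problem -/

/-- `u` solves `∂ₜ² u + a(t) H u + q(t) u = f` on `[0,T]`, `u(0) = u₀`, `∂ₜ u(0) = u₁`, in the sense of
`H`-distributions: for each test function `φ`, the function `t ↦ (u(t), φ)` is differentiable, its
derivative `t ↦ (u'(t), φ)` is absolutely continuous, and the equation, tested with `φ`, holds for
almost every `t`. The last two facts are expressed by the integrated equation; `(H w, φ) = (w, H φ)`. -/
def SolvesCauchy (T : ℝ) (a q : ℝ → ℝ) (f : ℝ → S.Distr) (u₀ u₁ : S.Distr) (u : ℝ → S.Distr) : Prop :=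
  ∃ u' : ℝ → S.Distr, u 0 = u₀ ∧ u' 0 = u₁ ∧ ∀ φ : S.Test,
    (∀ t ∈ Icc 0 T, HasDerivWithinAt (fun τ => S.pair (u τ) φ) (S.pair (u' t) φ) (Icc 0 T) t) ∧
    IntegrableOn (fun τ => S.pair (f τ) φ - a τ * S.pair (u τ) (S.hamTest φ)
      - q τ * S.pair (u τ) φ) (Icc 0 T) ∧
    ∀ t ∈ Icc 0 T, S.pair (u' t) φ = S.pair u₁ φ +
      ∫ τ in (0 : ℝ)..t, (S.pair (f τ) φ - a τ * S.pair (u τ) (S.hamTest φ)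
        - q τ * S.pair (u τ) φ)

/-- The classical solution: `u ∈ C([0,T]; H^{1+s}) ∩ C¹([0,T]; H^s)` solves the Cauchy problem. -/
def IsClassicalSolution (T s : ℝ) (a q : ℝ → ℝ) (f : ℝ → S.Distr) (u₀ u₁ : S.Distr)
    (u : ℝ → S.Distr) : Prop :=
  S.ContSob T (1 + s) u ∧ (∃ u' : ℝ → S.Distr, S.ContSob T s u' ∧ S.HasSobDeriv T s u u') ∧
    S.SolvesCauchy T a q f u₀ u₁ u

end DiscreteSchrodinger

/-! ### Regularisation by Friedrichs mollifiers -/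

/-- `a ∈ L^∞_1([0,T])`: `a` is bounded with derivative in `L^∞`, that is, Lipschitz on `[0,T]`.
(A differentiable function with essentially bounded derivative is Lipschitz.) -/
def MemLInftyOne (T : ℝ) (a : ℝ → ℝ) : Prop := ∃ C, LipschitzOnWith C a (Icc 0 T)

/-- Friedrichs mollifier: `ψ ∈ C₀^∞(ℝ)`, `ψ ≥ 0`, `∫ ψ = 1`. -/
structure IsMollifier (ψ : ℝ → ℝ) : Prop where
  smooth : ContDiff ℝ (⊤ : ℕ∞) ψ
  compact_support : HasCompactSupport ψ
  nonneg : ∀ t, 0 ≤ ψ t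
  integral_eq_one : ∫ t, ψ t = 1

/-- The scale function: positive on `(0,1]` with limit `0` as `ε → 0`. -/
def IsScale (r : ℝ → ℝ) : Prop :=
  (∀ ε ∈ Ioc (0 : ℝ) 1, 0 < r ε) ∧ Tendsto r (𝓝[>] 0) (𝓝 0)

/-- The convolution `(g * ψ_r)(t) = ∫ g(t - σ) r⁻¹ ψ(σ / r) dσ`. -/
def mollify {E : Type*} [NormedAddCommGroup E] [NormedSpace ℝ E] (ψ : ℝ → ℝ) (r : ℝ) (g : ℝ → E)
    (t : ℝ) : E := ∫ σ, (r⁻¹ * ψ (σ / r)) • g (t - σ)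

/-- `L^∞_m`-moderate nets of functions on `ℝ`. -/
def IsModerate (m : ℕ) (b : ℝ → ℝ → ℝ) : Prop :=
  ∀ K : Set ℝ, IsCompact K → ∃ (N : ℕ) (c : ℝ), 0 < c ∧ ∀ ε ∈ Ioc (0 : ℝ) 1, ∀ k ≤ m,
    eLpNorm (iteratedDeriv k (b ε)) ∞ (volume.restrict K) ≤
      ENNReal.ofReal (c * (ε⁻¹) ^ (N + k))

/-- `bε` is an `L^∞_m`-moderate regularisation of `b ∈ L^∞([0,T])`: the coefficient is extended to
some `B ∈ L^∞(ℝ)`, and `bε` is the convolution of `B` with a rescaled Friedrichs mollifier. -/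
def IsRegularisation (m : ℕ) (T : ℝ) (b : ℝ → ℝ) (bε : ℝ → ℝ → ℝ) : Prop :=
  ∃ (B ψ r : ℝ → ℝ), MemLp B ∞ volume ∧ (∀ᵐ t ∂volume.restrict (Icc 0 T), B t = b t) ∧
    IsMollifier ψ ∧ IsScale r ∧ (∀ ε ∈ Ioc (0 : ℝ) 1, bε ε = mollify ψ (r ε) B) ∧
    IsModerate m bε

/-- An `L^∞_1`-moderate regularisation of the propagation speed `a`, compatible with its strict
positivity: the extension `B` is nonnegative and either bounded below by a positive constant on a
neighbourhood of `[0,T]`, or arbitrary outside `[0,T]` (for instance zero there), in which case the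
mollifier has to charge both half-lines. -/
def IsPositiveRegularisation (T : ℝ) (a : ℝ → ℝ) (aε : ℝ → ℝ → ℝ) : Prop :=
  ∃ (B ψ r : ℝ → ℝ), MemLp B ∞ volume ∧ (∀ᵐ t ∂volume.restrict (Icc 0 T), B t = a t) ∧
    (∀ᵐ t, 0 ≤ B t) ∧
    ((∃ δ > 0, ∃ α > 0, ∀ᵐ t ∂volume.restrict (Ioo (-δ) (T + δ)), α ≤ B t) ∨
      ((∃ σ < 0, 0 < ψ σ) ∧ ∃ σ > 0, 0 < ψ σ)) ∧
    IsMollifier ψ ∧ IsScale r ∧ (∀ ε ∈ Ioc (0 : ℝ) 1, aε ε = mollify ψ (r ε) B) ∧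
    IsModerate 1 aε

namespace DiscreteSchrodinger

variable {n : ℕ} (S : DiscreteSchrodinger n)

/-- `L²([0,T]; H^s)`-moderate nets. -/
def IsModerateL2 (T s : ℝ) (fε : ℝ → ℝ → S.Distr) : Prop :=
  (∀ ε ∈ Ioc (0 : ℝ) 1, S.MemL2Sob (Icc 0 T) s (fε ε)) ∧
    ∃ (N : ℕ) (c : ℝ), 0 < c ∧ ∀ ε ∈ Ioc (0 : ℝ) 1,
      S.l2SobNorm (Icc 0 T) s (fε ε) ≤ ENNReal.ofReal (c * (ε⁻¹) ^ N)

/-- `fε` is an `L²([0,T]; H^s)`-moderate regularisation of `f ∈ L²([0,T]; H^s)`: the source is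
extended to some `F ∈ L²(ℝ; H^s)`, and `fε` is the convolution, in the time variable, of `F` with a
rescaled Friedrichs mollifier. -/
def IsSourceRegularisation (T s : ℝ) (f : ℝ → S.Distr) (fε : ℝ → ℝ → S.Distr) : Prop :=
  ∃ (F : ℝ → S.Distr) (ψ r : ℝ → ℝ), S.MemL2Sob univ s F ∧
    (∀ᵐ t ∂volume.restrict (Icc 0 T), F t = f t) ∧ IsMollifier ψ ∧ IsScale r ∧
    (∀ ε ∈ Ioc (0 : ℝ) 1, ∀ t, ∀ φ : S.Test,
      S.pair (fε ε t) φ = mollify ψ (r ε) (fun τ => S.pair (F τ) φ) t) ∧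
    S.IsModerateL2 T s fε

/-- `uε` is the very weak solution of order `s` associated with the regularising families `aε`, `qε`,
`fε` of the coefficients `a`, `q` and of the source `f`. -/
structure IsVeryWeakSolution (T s : ℝ) (a q : ℝ → ℝ) (f : ℝ → S.Distr) (u₀ u₁ : S.Distr)
    (aε qε : ℝ → ℝ → ℝ) (fε uε : ℝ → ℝ → S.Distr) : Prop where
  reg_a : IsPositiveRegularisation T a aε
  reg_q : IsRegularisation 0 T q qε
  reg_f : S.IsSourceRegularisation T s f fε
  solves : ∀ ε ∈ Ioc (0 : ℝ) 1, S.SolvesCauchy T (aε ε) (qε ε) (fε ε) u₀ u₁ (uε ε)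
  moderate : S.IsModerateL2 T (1 + s) uε

end DiscreteSchrodinger

end

/-! ### Mollification -/

/-! The eigenfunctions of `H` decouple the problem. With `λ = λ_ξ`, the coefficient `v_ε = (u_ε,
u_ξ)` solves the scalar equation `v'' + λ a_ε v + q_ε v = f_ε`, where `f_ε` now stands for its own
coefficient. The squared norm of `u_ε - u` is the sum over `ξ` of `(1 + λ)^(1+s) ∫ |v_ε - v|² dt`.
This sum tends to zero by dominated convergence, which needs a summable majorant uniform in small
`ε` and the convergence of each single mode.

The majorant comes from the energy estimate `wave_energy_le`. The extension of `a` may jump at `0`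
and `T`, so `a_ε'` can be as large as the inverse of the mollification scale near the end points.
The Grönwall exponent, however, contains only `∫ |a_ε'|`, which stays bounded: the two boundary
layers are as thin as the derivative is large, and between them `a_ε` inherits the Lipschitz
constant of `a` (`IsMollifier.integral_abs_mollify_deriv_le`). The energy controls the modes because
`a_ε` keeps a positive lower bound (`IsMollifier.exists_pos_le_mollify`), and Young's inequality
bounds the source modes by those of its extension.

For a fixed mode, `a_ε`, `q_ε` and the coefficient of `f_ε` converge in `L¹` on `[0,T]`, and a
second Grönwall argument (`IsModeSolution.norm_sub_le`) gives uniform convergence of `v_ε`. Its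
constants grow with `λ`, which is harmless since the majorant takes care of the sum. The modes of
`u` inherit the majorant in the limit, so `u` needs no energy estimate of its own. -/

theorem mollify_eq_integral {E : Type*} [NormedAddCommGroup E] [NormedSpace ℝ E] (ψ : ℝ → ℝ)
    {r : ℝ} (hr : 0 < r) (g : ℝ → E) (t : ℝ) :
    mollify ψ r g t = ∫ σ, ψ σ • g (t - r * σ) := by
  have h := Measure.integral_comp_div (fun y => ψ y • g (t - r * y)) r
  rw [abs_of_pos hr] at h
  rw [← inv_smul_smul₀ hr.ne' (∫ σ, ψ σ • g (t - r * σ)), ← h, ← integral_smul]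
  refine integral_congr_ae (Eventually.of_forall fun σ => ?_)
  simp only [mul_div_cancel₀ _ hr.ne', smul_smul]

/-- Reflection and translation preserve null sets. Hence any representative of `g` may be chosen: a
measurable one, or one that agrees with the given coefficient at every point of `[0,T]`. -/
theorem mollify_congr_ae {E : Type*} [NormedAddCommGroup E] [NormedSpace ℝ E] (ψ : ℝ → ℝ) (r : ℝ)
    {g g' : ℝ → E} (h : g =ᵐ[volume] g') : mollify ψ r g = mollify ψ r g' := by
  funext t
  have h' : ∀ᵐ σ : ℝ, g (t - σ) = g' (t - σ) :=
    (Measure.measurePreserving_sub_left volume t).quasiMeasurePreserving.ae h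
  exact integral_congr_ae (h'.mono fun σ hσ => by simp only [hσ])

theorem mollify_eq_convolution (ψ : ℝ → ℝ) (r : ℝ) {E : Type*} [NormedAddCommGroup E]
    [NormedSpace ℝ E] (g : ℝ → E) :
    mollify ψ r g = convolution (fun σ => r⁻¹ * ψ (σ / r)) g (ContinuousLinearMap.lsmul ℝ ℝ)
      volume := by
  funext t
  simp [mollify, convolution_def]

/-- The substitution `σ ↦ t - r σ` preserves almost-everywhere statements. -/
theorem ae_comp_sub_mul {r : ℝ} (hr : 0 < r) (t : ℝ) {p : ℝ → Prop} (h : ∀ᵐ x, p x) :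
    ∀ᵐ σ : ℝ, p (t - r * σ) := by
  have h1 : ∀ᵐ σ : ℝ, p (t - σ) :=
    (Measure.measurePreserving_sub_left volume t).quasiMeasurePreserving.ae h
  rw [ae_iff] at h1 ⊢
  have h2 := Real.volume_preimage_mul_left hr.ne' {a | ¬p (t - a)}
  rw [h1, mul_zero] at h2
  exact h2

namespace IsMollifier

variable {ψ : ℝ → ℝ}

theorem continuous (hψ : IsMollifier ψ) : Continuous ψ := hψ.smooth.continuous

theorem integrable (hψ : IsMollifier ψ) : Integrable ψ :=
  hψ.continuous.integrable_of_hasCompactSupport hψ.compact_support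

theorem lintegral_eq_one (hψ : IsMollifier ψ) : ∫⁻ σ, ENNReal.ofReal (ψ σ) = 1 := by
  rw [← ofReal_integral_eq_lintegral_ofReal hψ.integrable (Eventually.of_forall hψ.nonneg),
    hψ.integral_eq_one, ENNReal.ofReal_one]

theorem exists_radius (hψ : IsMollifier ψ) : ∃ R > 0, ∀ σ, ψ σ ≠ 0 → |σ| ≤ R := by
  obtain ⟨R, hR⟩ := hψ.compact_support.isCompact.isBounded.subset_closedBall 0
  -- The maximum with `1` makes the radius positive, so that smallness conditions on the scale can
  -- be written as quotients by `R`.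
  refine ⟨max R 1, by positivity, fun σ hσ => ?_⟩
  have := hR (subset_tsupport ψ hσ)
  rw [Metric.mem_closedBall, Real.dist_eq, sub_zero] at this
  exact this.trans (le_max_left _ _)

theorem enorm_mollify_le {E : Type*} [NormedAddCommGroup E] [NormedSpace ℝ E]
    (hψ : IsMollifier ψ) {r : ℝ} (hr : 0 < r) (g : ℝ → E) (t : ℝ) :
    ‖mollify ψ r g t‖ₑ ≤ ∫⁻ σ, ENNReal.ofReal (ψ σ) * ‖g (t - r * σ)‖ₑ := by
  rw [mollify_eq_integral ψ hr]
  refine (enorm_integral_le_lintegral_enorm _).trans_eq (lintegral_congr fun σ => ?_)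
  rw [enorm_smul, Real.enorm_eq_ofReal (hψ.nonneg σ)]

/-- Since `∫ ψ = 1`, the constant `c` is its own average, and the difference is the average of `g -
c`. -/
theorem enorm_mollify_sub_le {E : Type*} [NormedAddCommGroup E] [NormedSpace ℝ E]
    [CompleteSpace E] (hψ : IsMollifier ψ) {r : ℝ} (hr : 0 < r) {g : ℝ → E}
    (hg : StronglyMeasurable g) (t : ℝ) (c : E) :
    ‖mollify ψ r g t - c‖ₑ ≤ ∫⁻ σ, ENNReal.ofReal (ψ σ) * ‖g (t - r * σ) - c‖ₑ := by
  have hm : StronglyMeasurable fun σ => g (t - r * σ) := hg.comp_measurable (by fun_prop)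
  have he : ∀ σ, ENNReal.ofReal (ψ σ) * ‖g (t - r * σ) - c‖ₑ = ‖ψ σ • (g (t - r * σ) - c)‖ₑ :=
    fun σ => by rw [enorm_smul, Real.enorm_eq_ofReal (hψ.nonneg σ)]
  simp only [he]
  -- If the right side is infinite there is nothing to prove; if it is finite, it supplies the
  -- integrability needed to split the integral.
  by_cases hfin : ∫⁻ σ, ‖ψ σ • (g (t - r * σ) - c)‖ₑ = ∞
  · rw [hfin]; exact le_top
  · have hi : Integrable fun σ => ψ σ • (g (t - r * σ) - c) :=
      ⟨(hψ.continuous.stronglyMeasurable.smul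
        (hm.sub stronglyMeasurable_const)).aestronglyMeasurable, lt_top_iff_ne_top.2 hfin⟩
    have hc : Integrable fun σ => ψ σ • c := hψ.integrable.smul_const c
    have h1 : mollify ψ r g t - c = ∫ σ, ψ σ • (g (t - r * σ) - c) := by
      have h2 : ∫ σ, ψ σ • c = c := by
        rw [integral_smul_const, hψ.integral_eq_one, one_smul]
      have h3 := integral_add hi hc
      rw [h2] at h3
      rw [mollify_eq_integral ψ hr, sub_eq_iff_eq_add, ← h3]
      simp [smul_sub]
    rw [h1]
    exact enorm_integral_le_lintegral_enorm _

theorem norm_mollify_le {E : Type*} [NormedAddCommGroup E] [NormedSpace ℝ E]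
    (hψ : IsMollifier ψ) {r : ℝ} (hr : 0 < r) {g : ℝ → E} {M : ℝ}
    (hg : ∀ᵐ t, ‖g t‖ ≤ M) (t : ℝ) : ‖mollify ψ r g t‖ ≤ M := by
  rw [mollify_eq_integral ψ hr]
  have h1 : ∀ᵐ σ, ‖ψ σ • g (t - r * σ)‖ ≤ ψ σ * M := by
    filter_upwards [ae_comp_sub_mul hr t hg] with σ hσ
    rw [norm_smul, Real.norm_eq_abs, abs_of_nonneg (hψ.nonneg σ)]
    exact mul_le_mul_of_nonneg_left hσ (hψ.nonneg σ)
  refine (norm_integral_le_of_norm_le (hψ.integrable.mul_const M) h1).trans_eq ?_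
  rw [integral_mul_const, hψ.integral_eq_one, one_mul]

/-- Jensen's inequality for the mollifier. -/
theorem lintegral_mul_sq_le (hψ : IsMollifier ψ) {h : ℝ → ℝ≥0∞} (hh : Measurable h) :
    (∫⁻ σ, ENNReal.ofReal (ψ σ) * h σ) ^ (2 : ℝ) ≤ ∫⁻ σ, ENNReal.ofReal (ψ σ) * h σ ^ (2 : ℝ) := by
  have hw : Measurable fun σ => ENNReal.ofReal (ψ σ) := hψ.continuous.measurable.ennreal_ofReal
  -- `ψ dσ` is a probability measure, so the claim is Hölder's inequality against the constant `1`.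
  let P : Measure ℝ := volume.withDensity fun σ => ENNReal.ofReal (ψ σ)
  have hP : ∀ k : ℝ → ℝ≥0∞, Measurable k → ∫⁻ σ, k σ ∂P = ∫⁻ σ, ENNReal.ofReal (ψ σ) * k σ :=
    fun k hk => lintegral_withDensity_eq_lintegral_mul volume hw hk
  rw [← hP _ hh, ← hP _ (hh.pow_const _)]
  have hone : ∫⁻ _, (1 : ℝ≥0∞) ∂P = 1 := by
    rw [hP _ measurable_const]; simpa using hψ.lintegral_eq_one
  have h2 := ENNReal.lintegral_mul_le_Lp_mul_Lq P (p := 2) (q := 2) Real.HolderConjugate.two_two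
    hh.aemeasurable (measurable_const (a := (1 : ℝ≥0∞))).aemeasurable
  simp only [Pi.mul_apply, mul_one, ENNReal.one_rpow, hone] at h2
  calc (∫⁻ σ, h σ ∂P) ^ (2 : ℝ) ≤ ((∫⁻ σ, h σ ^ (2 : ℝ) ∂P) ^ (1 / 2 : ℝ)) ^ (2 : ℝ) := by
        gcongr
    _ = _ := by rw [← ENNReal.rpow_mul]; norm_num

/-- Young's inequality: mollification is a contraction of `L²`. -/
theorem lintegral_enorm_mollify_sq_le {E : Type*} [NormedAddCommGroup E] [NormedSpace ℝ E]
    (hψ : IsMollifier ψ) {r : ℝ} (hr : 0 < r) {g : ℝ → E} (hg : AEStronglyMeasurable g) :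
    ∫⁻ t, ‖mollify ψ r g t‖ₑ ^ (2 : ℝ) ≤ ∫⁻ t, ‖g t‖ₑ ^ (2 : ℝ) := by
  obtain ⟨g', hg', hgg'⟩ := hg
  have he : ∫⁻ t, ‖g t‖ₑ ^ (2 : ℝ) = ∫⁻ t, ‖g' t‖ₑ ^ (2 : ℝ) :=
    lintegral_congr_ae (hgg'.mono fun t ht => by simp only [ht])
  rw [mollify_congr_ae ψ r hgg', he]
  have hw : Measurable fun σ => ENNReal.ofReal (ψ σ) := hψ.continuous.measurable.ennreal_ofReal
  have hm : Measurable fun t => ‖g' t‖ₑ := hg'.enorm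
  calc ∫⁻ t, ‖mollify ψ r g' t‖ₑ ^ (2 : ℝ)
      ≤ ∫⁻ t, ∫⁻ σ, ENNReal.ofReal (ψ σ) * ‖g' (t - r * σ)‖ₑ ^ (2 : ℝ) :=
        lintegral_mono fun t => (ENNReal.rpow_le_rpow (hψ.enorm_mollify_le hr g' t)
          (by norm_num)).trans (hψ.lintegral_mul_sq_le (hm.comp (by fun_prop)))
    -- Tonelli; for fixed `σ` the inner integral no longer depends on the shift `r σ`, by
    -- translation invariance.
    _ = ∫⁻ σ, ∫⁻ t, ENNReal.ofReal (ψ σ) * ‖g' (t - r * σ)‖ₑ ^ (2 : ℝ) := by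
        refine lintegral_lintegral_swap (Measurable.aemeasurable ?_)
        exact (hw.comp measurable_snd).mul ((hm.comp (by fun_prop)).pow_const _)
    _ = ∫⁻ σ, ENNReal.ofReal (ψ σ) * ∫⁻ t, ‖g' t‖ₑ ^ (2 : ℝ) := by
        refine lintegral_congr fun σ => ?_
        have hσ : Measurable fun t => ‖g' (t - r * σ)‖ₑ :=
          hm.comp (measurable_id.sub_const (r * σ))
        rw [lintegral_const_mul _ (hσ.pow_const _),
          lintegral_sub_right_eq_self (fun t => ‖g' t‖ₑ ^ (2 : ℝ)) (r * σ)]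
    _ = ∫⁻ t, ‖g' t‖ₑ ^ (2 : ℝ) := by
        rw [lintegral_mul_const _ hw, hψ.lintegral_eq_one, one_mul]

end IsMollifier

/-! ### Convergence of mollifications in `L¹` -/

/-- Translation is continuous in `L¹`. -/
theorem tendsto_lintegral_enorm_translate_sub {E : Type*} [NormedAddCommGroup E] [NormedSpace ℝ E]
    {g : ℝ → E} (hg : Integrable g) :
    Tendsto (fun h => ∫⁻ t, ‖g (t - h) - g t‖ₑ) (𝓝 0) (𝓝 0) := by
  rw [ENNReal.tendsto_nhds_zero]
  intro ε hε
  -- Density of continuous compactly supported functions: two thirds of `ε` pay for the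
  -- approximation error before and after translation, one third for the translation of `φ`.
  obtain ⟨φ, hφs, hφε, hφc, hφi⟩ := hg.exists_hasCompactSupport_lintegral_sub_le
    (ε := ε / 3) (ENNReal.div_pos hε.ne' (by norm_num)).ne'
  have hφ : Tendsto (fun h => ∫⁻ t, ‖φ (t - h) - φ t‖ₑ) (𝓝 0) (𝓝 0) := by
    obtain ⟨C, hC⟩ := hφs.exists_bound_of_continuous hφc
    obtain ⟨R, hR⟩ := hφs.isCompact.isBounded.subset_closedBall 0
    have hφ0 : ∀ t, R < |t| → φ t = 0 := fun t ht => by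
      by_contra h
      have := hR (subset_tsupport φ h)
      rw [Metric.mem_closedBall, Real.dist_eq, sub_zero] at this
      linarith
    have h0 : (∫⁻ t : ℝ, ‖φ (t - 0) - φ t‖ₑ) = 0 := by simp
    rw [← h0]
    -- For `|h| ≤ 1` every translate of `φ` vanishes outside the ball of radius `R + 1`, which gives
    -- an integrable dominating function.
    refine tendsto_lintegral_filter_of_dominated_convergence
      ((Metric.closedBall (0 : ℝ) (R + 1)).indicator fun _ => ENNReal.ofReal (C + C))
      (Eventually.of_forall fun h => ?_) ?_ ?_ (Eventually.of_forall fun t => ?_)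
    · exact (Continuous.enorm (by fun_prop)).measurable
    · filter_upwards [Metric.closedBall_mem_nhds (0 : ℝ) one_pos] with h hh
      refine Eventually.of_forall fun t => ?_
      rw [Metric.mem_closedBall, Real.dist_eq, sub_zero] at hh
      by_cases ht : t ∈ Metric.closedBall (0 : ℝ) (R + 1)
      · rw [indicator_of_mem ht, ← ofReal_norm]
        exact ENNReal.ofReal_le_ofReal ((norm_sub_le _ _).trans (add_le_add (hC _) (hC _)))
      · rw [Metric.mem_closedBall, Real.dist_eq, sub_zero, not_le] at ht
        have h1 : |t| ≤ |t - h| + |h| := by simpa using abs_add_le (t - h) h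
        rw [hφ0 t (by linarith), hφ0 (t - h) (by linarith)]
        simp
    · rw [lintegral_indicator Metric.isClosed_closedBall.measurableSet, lintegral_const]
      exact (ENNReal.mul_lt_top ENNReal.ofReal_lt_top (by
        rw [Measure.restrict_apply_univ]; exact measure_closedBall_lt_top)).ne
    · have hc : Continuous fun h => ‖φ (t - h) - φ t‖ₑ := Continuous.enorm (by fun_prop)
      exact hc.tendsto 0
  filter_upwards [(ENNReal.tendsto_nhds_zero.1 hφ) (ε / 3) (ENNReal.div_pos hε.ne' (by norm_num))]
    with h hh
  have hm : AEMeasurable (fun t => ‖g t - φ t‖ₑ) := (hg.sub hφi).1.enorm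
  have hmh : AEMeasurable (fun t => ‖g (t - h) - φ (t - h)‖ₑ) :=
    hm.comp_quasiMeasurePreserving (measurePreserving_sub_right volume h).quasiMeasurePreserving
  have hcφ : AEMeasurable fun t => ‖φ (t - h) - φ t‖ₑ :=
    (Continuous.enorm (by fun_prop)).measurable.aemeasurable
  calc ∫⁻ t, ‖g (t - h) - g t‖ₑ
      ≤ ∫⁻ t, (‖g (t - h) - φ (t - h)‖ₑ + ‖φ (t - h) - φ t‖ₑ + ‖g t - φ t‖ₑ) := by
        refine lintegral_mono fun t => ?_
        have : g (t - h) - g t = (g (t - h) - φ (t - h)) + (φ (t - h) - φ t) - (g t - φ t) := by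
          abel
        rw [this]
        refine (enorm_sub_le).trans ?_
        gcongr
        exact enorm_add_le _ _
    _ = (∫⁻ t, ‖g (t - h) - φ (t - h)‖ₑ) + (∫⁻ t, ‖φ (t - h) - φ t‖ₑ)
          + ∫⁻ t, ‖g t - φ t‖ₑ := by
        rw [lintegral_add_right' _ hm, lintegral_add_right' _ hcφ]
    _ ≤ ε / 3 + ε / 3 + ε / 3 := by
        rw [lintegral_sub_right_eq_self (fun t => ‖g t - φ t‖ₑ) h]
        gcongr
    _ = ε := ENNReal.add_thirds ε

namespace IsMollifier

variable {ψ : ℝ → ℝ}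

/-- Mollifications of an integrable function converge in `L¹`. -/
theorem tendsto_lintegral_enorm_mollify_sub {E : Type*} [NormedAddCommGroup E] [NormedSpace ℝ E]
    [CompleteSpace E] (hψ : IsMollifier ψ) {g : ℝ → E} (hg : Integrable g) :
    Tendsto (fun r => ∫⁻ t, ‖mollify ψ r g t - g t‖ₑ) (𝓝[>] 0) (𝓝 0) := by
  wlog hgm : StronglyMeasurable g generalizing g
  · obtain ⟨g', hg', hgg'⟩ := hg.1
    refine (this (hg.congr hgg') hg').congr fun r => ?_
    rw [mollify_congr_ae ψ r hgg']
    exact lintegral_congr_ae (hgg'.mono fun t ht => by simp only [ht])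
  have hw : Measurable fun σ => ENNReal.ofReal (ψ σ) := hψ.continuous.measurable.ennreal_ofReal
  rw [ENNReal.tendsto_nhds_zero]
  intro ε hε
  obtain ⟨R, hR0, hR⟩ := hψ.exists_radius
  obtain ⟨δ, hδ0, hδ⟩ := Metric.eventually_nhds_iff.1
    (ENNReal.tendsto_nhds_zero.1 (tendsto_lintegral_enorm_translate_sub hg) ε hε)
  -- For `r < δ / R` all shifts `r σ` with `σ` in the support of `ψ` are shorter than `δ`, so the
  -- translation estimate holds uniformly under the average.
  filter_upwards [Ioo_mem_nhdsGT (show 0 < δ / R by positivity)] with r hr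
  have hrR : r * R < δ := (lt_div_iff₀ hR0).1 hr.2
  have hm2 : Measurable fun p : ℝ × ℝ => ‖g (p.1 - r * p.2) - g p.1‖ₑ :=
    ((hgm.comp_measurable (by fun_prop)).sub (hgm.comp_measurable (by fun_prop))).enorm
  calc ∫⁻ t, ‖mollify ψ r g t - g t‖ₑ
      ≤ ∫⁻ t, ∫⁻ σ, ENNReal.ofReal (ψ σ) * ‖g (t - r * σ) - g t‖ₑ :=
        lintegral_mono fun t => hψ.enorm_mollify_sub_le hr.1 hgm t (g t)
    _ = ∫⁻ σ, ∫⁻ t, ENNReal.ofReal (ψ σ) * ‖g (t - r * σ) - g t‖ₑ :=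
        lintegral_lintegral_swap ((hw.comp measurable_snd).mul hm2).aemeasurable
    _ ≤ ∫⁻ σ, ENNReal.ofReal (ψ σ) * ε := by
        refine lintegral_mono fun σ => ?_
        have hσm : Measurable fun t => ‖g (t - r * σ) - g t‖ₑ :=
          hm2.comp (measurable_id.prodMk measurable_const)
        rw [lintegral_const_mul _ hσm]
        by_cases hσ : ψ σ = 0
        · simp [hσ]
        · refine mul_le_mul_right (hδ ?_) _
          rw [Real.dist_eq, sub_zero, abs_mul, abs_of_pos hr.1]
          exact (mul_le_mul_of_nonneg_left (hR σ hσ) hr.1.le).trans_lt hrR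
    _ = ε := by rw [lintegral_mul_const _ hw, hψ.lintegral_eq_one, one_mul]

/-- Mollifications at a small scale depend only on values nearby. -/
theorem mollify_congr_of_near {E : Type*} [NormedAddCommGroup E] [NormedSpace ℝ E] {R r : ℝ}
    (hR : ∀ σ, ψ σ ≠ 0 → |σ| ≤ R) (hr : 0 < r) {g g' : ℝ → E} {t : ℝ}
    (h : ∀ y, |y - t| ≤ r * R → g y = g' y) : mollify ψ r g t = mollify ψ r g' t := by
  rw [mollify_eq_integral ψ hr, mollify_eq_integral ψ hr]
  refine integral_congr_ae (Eventually.of_forall fun σ => ?_)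
  by_cases hσ : ψ σ = 0
  · simp [hσ]
  · simp only
    rw [h]
    rw [sub_sub_cancel_left, abs_neg, abs_mul, abs_of_pos hr]
    exact mul_le_mul_of_nonneg_left (hR σ hσ) hr.le

/-- Mollifications of a locally integrable function converge in `L¹` on bounded intervals. -/
theorem tendsto_setLIntegral_enorm_mollify_sub {E : Type*} [NormedAddCommGroup E]
    [NormedSpace ℝ E] [CompleteSpace E] (hψ : IsMollifier ψ) {g : ℝ → E}
    (hg : LocallyIntegrable g) (T : ℝ) :
    Tendsto (fun r => ∫⁻ t in Icc 0 T, ‖mollify ψ r g t - g t‖ₑ) (𝓝[>] 0) (𝓝 0) := by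
  obtain ⟨R, hR0, hR⟩ := hψ.exists_radius
  -- Cutting off to `[-1, T + 1]` makes `g` integrable, and on `[0,T]` mollifications of reach `r R
  -- < 1` do not see the cut.
  let g₁ : ℝ → E := (Icc (-1) (T + 1)).indicator g
  have hg₁ : Integrable g₁ :=
    (integrable_indicator_iff measurableSet_Icc).2 (hg.integrableOn_isCompact isCompact_Icc)
  refine tendsto_of_tendsto_of_tendsto_of_le_of_le' tendsto_const_nhds
    (hψ.tendsto_lintegral_enorm_mollify_sub hg₁) (Eventually.of_forall fun _ => zero_le) ?_
  filter_upwards [Ioo_mem_nhdsGT (show 0 < 1 / R by positivity)] with r hr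
  have hrR : r * R < 1 := (lt_div_iff₀ hR0).1 hr.2
  refine (setLIntegral_congr_fun measurableSet_Icc fun t ht => ?_).trans_le
    (setLIntegral_le_lintegral (Icc 0 T) fun t => ‖mollify ψ r g₁ t - g₁ t‖ₑ)
  have hnear : ∀ y, |y - t| ≤ r * R → g y = g₁ y := fun y hy => by
    have := abs_le.1 (hy.trans hrR.le)
    exact (indicator_of_mem (show y ∈ Icc (-1) (T + 1) from
      ⟨by linarith [ht.1], by linarith [ht.2]⟩) g).symm
  rw [mollify_congr_of_near hR hr.1 hnear, hnear t (by
    rw [sub_self, abs_zero]; exact mul_nonneg hr.1.le hR0.le)]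

end IsMollifier

/-! ### Derivatives, variation and positivity of mollifications -/

theorem ae_norm_le_of_memLp_top {α E : Type*} [MeasurableSpace α] [NormedAddCommGroup E]
    {μ : Measure α} {g : α → E} (hg : MemLp g ∞ μ) : ∃ M, 0 ≤ M ∧ ∀ᵐ t ∂μ, ‖g t‖ ≤ M := by
  refine ⟨(eLpNormEssSup g μ).toReal, ENNReal.toReal_nonneg, ?_⟩
  have hfin : eLpNormEssSup g μ < ∞ := by simpa using hg.2
  filter_upwards [enorm_ae_le_eLpNormEssSup g μ] with t ht
  have := ENNReal.toReal_mono hfin.ne ht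
  simpa using this

namespace IsMollifier

variable {ψ : ℝ → ℝ}

theorem hasCompactSupport_rescale (hψ : IsMollifier ψ) {r : ℝ} (hr : 0 < r) :
    HasCompactSupport fun σ => r⁻¹ * ψ (σ / r) := by
  obtain ⟨R, -, hR⟩ := hψ.exists_radius
  refine HasCompactSupport.intro (isCompact_closedBall (0 : ℝ) (r * R)) fun σ hσ => ?_
  by_contra h
  have h1 := hR (σ / r) fun h0 => h (by rw [h0, mul_zero])
  rw [abs_div, abs_of_pos hr, div_le_iff₀ hr] at h1
  exact hσ (by rw [Metric.mem_closedBall, Real.dist_eq, sub_zero]; linarith)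

theorem contDiff_rescale (hψ : IsMollifier ψ) (r : ℝ) :
    ContDiff ℝ 1 fun σ => r⁻¹ * ψ (σ / r) :=
  contDiff_const.mul ((hψ.smooth.of_le (by exact_mod_cast le_top)).comp
    (contDiff_id.div_const r))

theorem continuous_mollify {E : Type*} [NormedAddCommGroup E] [NormedSpace ℝ E]
    (hψ : IsMollifier ψ) {r : ℝ} (hr : 0 < r) {g : ℝ → E} (hg : LocallyIntegrable g) :
    Continuous (mollify ψ r g) := by
  rw [mollify_eq_convolution]
  exact (hψ.hasCompactSupport_rescale hr).continuous_convolution_left _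
    (hψ.contDiff_rescale r).continuous hg

theorem deriv_rescale (hψ : IsMollifier ψ) (r : ℝ) :
    deriv (fun σ => r⁻¹ * ψ (σ / r)) = fun σ => r⁻¹ * (r⁻¹ * deriv ψ (σ / r)) := by
  funext σ
  have h1 : HasDerivAt ψ (deriv ψ (σ / r)) (σ / r) :=
    (hψ.smooth.differentiable (by simp) _).hasDerivAt
  have h2 := ((h1.comp σ ((hasDerivAt_id σ).div_const r)).const_mul r⁻¹).deriv
  simp only [Function.comp_def, id] at h2
  rw [h2]
  ring

/-- The derivative falls on the kernel, so `g` needs no regularity; the price is the factor `r⁻¹`.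
-/
theorem hasDerivAt_mollify {E : Type*} [NormedAddCommGroup E] [NormedSpace ℝ E] [CompleteSpace E]
    (hψ : IsMollifier ψ) {r : ℝ} (hr : 0 < r) {g : ℝ → E} (hg : LocallyIntegrable g) (t : ℝ) :
    HasDerivAt (mollify ψ r g) (r⁻¹ • mollify (deriv ψ) r g t) t := by
  have h := (hψ.hasCompactSupport_rescale hr).hasDerivAt_convolution_left
    (ContinuousLinearMap.lsmul ℝ ℝ) (hψ.contDiff_rescale r) hg t
  rw [← mollify_eq_convolution, hψ.deriv_rescale] at h
  convert h using 1
  simp only [mollify, convolution_def, ContinuousLinearMap.lsmul_apply, ← integral_smul, smul_smul]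

theorem continuous_mollify_deriv {E : Type*} [NormedAddCommGroup E] [NormedSpace ℝ E]
    (hψ : IsMollifier ψ) {r : ℝ} (hr : 0 < r) {g : ℝ → E} (hg : LocallyIntegrable g) :
    Continuous fun t => r⁻¹ • mollify (deriv ψ) r g t := by
  have h : (fun t => r⁻¹ • mollify (deriv ψ) r g t) =
      convolution (deriv fun σ => r⁻¹ * ψ (σ / r)) g (ContinuousLinearMap.lsmul ℝ ℝ) volume := by
    funext t
    rw [hψ.deriv_rescale]
    simp only [mollify, convolution_def, ContinuousLinearMap.lsmul_apply, ← integral_smul,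
      smul_smul]
  rw [h]
  exact (hψ.hasCompactSupport_rescale hr).deriv.continuous_convolution_left _
    ((hψ.contDiff_rescale r).continuous_deriv le_rfl) hg

/-- A crude bound that blows up like `r⁻¹`. It serves in the boundary layers, where the width `r R`
compensates. -/
theorem norm_mollify_deriv_le {E : Type*} [NormedAddCommGroup E] [NormedSpace ℝ E]
    (hψ : IsMollifier ψ) {r : ℝ} (hr : 0 < r) {g : ℝ → E} {M : ℝ}
    (hg : ∀ᵐ t, ‖g t‖ ≤ M) (t : ℝ) :
    ‖r⁻¹ • mollify (deriv ψ) r g t‖ ≤ r⁻¹ * ((∫ σ, |deriv ψ σ|) * M) := by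
  have hi : Integrable fun σ => |deriv ψ σ| :=
    ((hψ.smooth.continuous_deriv (by simp)).integrable_of_hasCompactSupport
      hψ.compact_support.deriv).abs
  rw [norm_smul, Real.norm_eq_abs, abs_of_pos (inv_pos.2 hr), mollify_eq_integral _ hr,
    ← integral_mul_const]
  refine mul_le_mul_of_nonneg_left (norm_integral_le_of_norm_le (hi.mul_const M) ?_)
    (inv_pos.2 hr).le
  filter_upwards [ae_comp_sub_mul hr t hg] with σ hσ
  rw [norm_smul, Real.norm_eq_abs]
  exact mul_le_mul_of_nonneg_left hσ (abs_nonneg _)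

theorem integrable_smul_comp {E : Type*} [NormedAddCommGroup E] [NormedSpace ℝ E]
    (hψ : IsMollifier ψ) {r : ℝ} (hr : 0 < r) {g : ℝ → E} (hg : MemLp g ∞ volume) (t : ℝ) :
    Integrable fun σ => ψ σ • g (t - r * σ) := by
  obtain ⟨M, hM0, hM⟩ := ae_norm_le_of_memLp_top hg
  have hm : AEStronglyMeasurable fun σ => g (t - r * σ) := by
    obtain ⟨g', hg', hgg'⟩ := hg.1
    exact ⟨fun σ => g' (t - r * σ), hg'.comp_measurable (by fun_prop),
      ae_comp_sub_mul hr t hgg'⟩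
  exact hψ.integrable.smul_bdd M hm (ae_comp_sub_mul hr t hM)

/-- If `g` is Lipschitz near `[t, t']`, so is its mollification. -/
theorem norm_mollify_sub_mollify_le (hψ : IsMollifier ψ) {R : ℝ} (hR : ∀ σ, ψ σ ≠ 0 → |σ| ≤ R)
    {r : ℝ} (hr : 0 < r) {g : ℝ → ℝ} (hg : MemLp g ∞ volume) {C T : ℝ}
    (hC : ∀ x ∈ Icc 0 T, ∀ y ∈ Icc 0 T, |g x - g y| ≤ C * |x - y|) {t t' : ℝ}
    (ht : t ∈ Icc (r * R) (T - r * R)) (ht' : t' ∈ Icc (r * R) (T - r * R)) :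
    |mollify ψ r g t - mollify ψ r g t'| ≤ C * |t - t'| := by
  -- At distance at least `r R` from both end points, the averaging window stays inside `[0,T]`,
  -- where `g` is Lipschitz.
  have hmem : ∀ σ, ψ σ ≠ 0 → ∀ x ∈ Icc (r * R) (T - r * R), x - r * σ ∈ Icc 0 T := by
    intro σ hσ x hx
    have h := abs_le.1 (hR σ hσ)
    have h1 := mul_le_mul_of_nonneg_left h.1 hr.le
    have h2 := mul_le_mul_of_nonneg_left h.2 hr.le
    exact ⟨by linarith [hx.1], by linarith [hx.2]⟩
  rw [mollify_eq_integral ψ hr, mollify_eq_integral ψ hr,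
    ← integral_sub (hψ.integrable_smul_comp hr hg t) (hψ.integrable_smul_comp hr hg t'),
    ← Real.norm_eq_abs]
  refine (norm_integral_le_of_norm_le (hψ.integrable.mul_const (C * |t - t'|))
    (Eventually.of_forall fun σ => ?_)).trans_eq (by
      rw [integral_mul_const, hψ.integral_eq_one, one_mul])
  rw [← smul_sub, norm_smul, Real.norm_eq_abs, abs_of_nonneg (hψ.nonneg σ), Real.norm_eq_abs]
  by_cases hσ : ψ σ = 0
  · simp [hσ]
  · refine mul_le_mul_of_nonneg_left ?_ (hψ.nonneg σ)
    simpa using hC _ (hmem σ hσ t ht) _ (hmem σ hσ t' ht')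

theorem setIntegral_pos_of_pos (hψ : IsMollifier ψ) {U : Set ℝ} (hU : IsOpen U) {σ : ℝ}
    (hσU : σ ∈ U) (hσ : 0 < ψ σ) : 0 < ∫ σ in U, ψ σ := by
  rw [setIntegral_pos_iff_support_of_nonneg_ae (Eventually.of_forall hψ.nonneg)
    hψ.integrable.integrableOn]
  have ho : IsOpen (Function.support ψ ∩ U) :=
    (isOpen_ne_fun hψ.continuous continuous_const).inter hU
  exact ho.measure_pos volume ⟨σ, hσ.ne', hσU⟩

/-- A lower bound for the mollification of a nonnegative function which is bounded below on the part
of the neighbourhood of `t` seen through `U`. -/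
theorem le_mollify (hψ : IsMollifier ψ) {R : ℝ} (hR : ∀ σ, ψ σ ≠ 0 → |σ| ≤ R)
    {r : ℝ} (hr : 0 < r) {g : ℝ → ℝ} (hg : MemLp g ∞ volume) (hg0 : ∀ᵐ t, 0 ≤ g t)
    {U J : Set ℝ} (hU : MeasurableSet U) {α t : ℝ} (hJ : ∀ᵐ x, x ∈ J → α ≤ g x)
    (ht : ∀ σ ∈ U, |σ| ≤ R → t - r * σ ∈ J) :
    (∫ σ in U, ψ σ) * α ≤ mollify ψ r g t := by
  rw [mollify_eq_integral ψ hr, ← integral_mul_const]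
  have hi := hψ.integrable_smul_comp hr hg t
  refine (setIntegral_mono_ae_restrict (hψ.integrable.integrableOn.mul_const α)
    hi.integrableOn ?_).trans (setIntegral_le_integral hi ?_)
  · filter_upwards [ae_restrict_mem hU, ae_restrict_of_ae (ae_comp_sub_mul hr t hJ)] with σ hσ h
    by_cases h0 : ψ σ = 0
    · simp [h0]
    · exact mul_le_mul_of_nonneg_left (h (ht σ hσ (hR σ h0))) (hψ.nonneg σ)
  · filter_upwards [ae_comp_sub_mul hr t hg0] with σ hσ
    exact mul_nonneg (hψ.nonneg σ) hσ

end IsMollifier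

namespace IsMollifier

variable {ψ : ℝ → ℝ}

/-- The mollifications of a bounded function which is Lipschitz on `[0,T]`, but may jump at the end
points, have uniformly bounded variation on `[0,T]`. -/
theorem integral_abs_mollify_deriv_le (hψ : IsMollifier ψ) {R : ℝ}
    (hR : ∀ σ, ψ σ ≠ 0 → |σ| ≤ R) (hR0 : 0 < R) {r : ℝ} (hr : 0 < r) {g : ℝ → ℝ}
    (hg : MemLp g ∞ volume) {M T : ℝ} {C : NNReal} (hM : ∀ᵐ t, ‖g t‖ ≤ M)
    (hC : LipschitzOnWith C g (Icc 0 T)) (hrT : r * R ≤ T - r * R) :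
    ∫ t in (0 : ℝ)..T, |r⁻¹ • mollify (deriv ψ) r g t| ≤
      2 * R * ((∫ σ, |deriv ψ σ|) * M) + C * T := by
  have hgl : LocallyIntegrable g := hg.locallyIntegrable le_top
  set α' : ℝ → ℝ := fun t => r⁻¹ • mollify (deriv ψ) r g t with hα'
  set D := (∫ σ, |deriv ψ σ|) * M
  have hrR : 0 < r * R := mul_pos hr hR0
  have hc : Continuous fun t => |α' t| := (hψ.continuous_mollify_deriv hr hgl).abs
  have hi : ∀ x y, IntervalIntegrable (fun t => |α' t|) volume x y := hc.intervalIntegrable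
  have hb : ∀ t, |α' t| ≤ r⁻¹ * D := fun t => hψ.norm_mollify_deriv_le hr hM t
  have hlip : LipschitzOnWith C (mollify ψ r g) (Icc (r * R) (T - r * R)) :=
    LipschitzOnWith.of_dist_le_mul fun t ht t' ht' =>
      hψ.norm_mollify_sub_mollify_le hR hr hg (fun x hx y hy => hC.dist_le_mul x hx y hy) ht ht'
  -- Layer width `r R` times the bound `r⁻¹ D`: the scale cancels.
  have h1 : ∫ t in (0 : ℝ)..(r * R), |α' t| ≤ R * D := by
    refine (intervalIntegral.integral_mono_on hrR.le (hi _ _)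
      (continuous_const.intervalIntegrable _ _) fun t _ => hb t).trans_eq ?_
    rw [intervalIntegral.integral_const, smul_eq_mul]
    field_simp
    ring
  have h3 : ∫ t in (T - r * R)..T, |α' t| ≤ R * D := by
    refine (intervalIntegral.integral_mono_on (by linarith) (hi _ _)
      (continuous_const.intervalIntegrable _ _) fun t _ => hb t).trans_eq ?_
    rw [intervalIntegral.integral_const, smul_eq_mul]
    field_simp
    ring
  -- Away from the end points the derivative is at most the Lipschitz constant.
  have h2 : ∫ t in (r * R)..(T - r * R), |α' t| ≤ C * T := by
    refine (intervalIntegral.integral_mono_on_of_le_Ioo hrT (hi _ _)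
      (continuous_const.intervalIntegrable _ _) (g := fun _ => (C : ℝ)) fun t ht => ?_).trans ?_
    · exact (hψ.hasDerivAt_mollify hr hgl t).le_of_lipschitzOn (Icc_mem_nhds ht.1 ht.2) hlip
    · rw [intervalIntegral.integral_const, smul_eq_mul, mul_comm]
      exact mul_le_mul_of_nonneg_left (by linarith) C.2
  rw [← intervalIntegral.integral_add_adjacent_intervals (hi 0 (r * R)) (hi _ _),
    ← intervalIntegral.integral_add_adjacent_intervals (hi (r * R) (T - r * R)) (hi _ _)]
  linarith

/-- Strict positivity survives mollification: either the function is bounded below on a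
neighbourhood of `[0,T]`, or the mollifier charges both half-lines. -/
theorem exists_pos_le_mollify (hψ : IsMollifier ψ) {T : ℝ} (hT : 0 < T) {g : ℝ → ℝ}
    (hg : MemLp g ∞ volume) (hg0 : ∀ᵐ t, 0 ≤ g t) {a₀ : ℝ} (ha₀ : 0 < a₀)
    (hga : ∀ t ∈ Icc 0 T, a₀ ≤ g t)
    (hpos : (∃ δ > 0, ∃ α > 0, ∀ᵐ t ∂volume.restrict (Ioo (-δ) (T + δ)), α ≤ g t) ∨
      ((∃ σ < 0, 0 < ψ σ) ∧ ∃ σ > 0, 0 < ψ σ)) :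
    ∃ c > 0, ∀ᶠ r in 𝓝[>] (0 : ℝ), ∀ t ∈ Icc 0 T, c ≤ mollify ψ r g t := by
  obtain ⟨R, hR0, hR⟩ := hψ.exists_radius
  have hsmall : ∀ {η : ℝ}, 0 < η → ∀ᶠ r in 𝓝[>] (0 : ℝ), 0 < r ∧ r * R < η := fun {η} hη => by
    filter_upwards [Ioo_mem_nhdsGT (show 0 < η / R by positivity)] with r hr
    exact ⟨hr.1, (lt_div_iff₀ hR0).1 hr.2⟩
  have habs : ∀ {r σ : ℝ}, 0 < r → |σ| ≤ R → -(r * R) ≤ r * σ ∧ r * σ ≤ r * R :=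
    fun {r σ} hr hσ => ⟨by nlinarith [(abs_le.1 hσ).1], by nlinarith [(abs_le.1 hσ).2]⟩
  rcases hpos with ⟨δ, hδ, α, hα, hgα⟩ | ⟨⟨σ₁, hσ₁, hψ₁⟩, σ₂, hσ₂, hψ₂⟩
  · refine ⟨α, hα, ?_⟩
    filter_upwards [hsmall hδ] with r hr t ht
    have h := hψ.le_mollify hR hr.1 hg hg0 MeasurableSet.univ (t := t)
      ((ae_restrict_iff' measurableSet_Ioo).1 hgα) (fun σ _ hσ => by
        have := habs hr.1 hσ
        exact ⟨by linarith [ht.1, hr.2], by linarith [ht.2, hr.2]⟩)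
    rwa [setIntegral_univ, hψ.integral_eq_one, one_mul] at h
  · have h₁ := hψ.setIntegral_pos_of_pos isOpen_Iio (show σ₁ ∈ Iio 0 from hσ₁) hψ₁
    have h₂ := hψ.setIntegral_pos_of_pos isOpen_Ioi (show σ₂ ∈ Ioi 0 from hσ₂) hψ₂
    refine ⟨min ((∫ σ in Iio 0, ψ σ) * a₀) ((∫ σ in Ioi 0, ψ σ) * a₀),
      lt_min (mul_pos h₁ ha₀) (mul_pos h₂ ha₀), ?_⟩
    filter_upwards [hsmall (show 0 < T / 2 by positivity)] with r hr t ht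
    have hJ : ∀ᵐ x, x ∈ Icc 0 T → a₀ ≤ g x := Eventually.of_forall hga
    -- In the left half of `[0,T]` negative `σ` moves `t - r σ` to the right, in the right half
    -- positive `σ` moves it to the left; as `r R < T / 2`, it stays in `[0,T]`. The mass of `ψ` on
    -- the corresponding half-line therefore multiplies `a₀`.
    rcases le_total t (T / 2) with htT | htT
    · refine (min_le_left _ _).trans (hψ.le_mollify hR hr.1 hg hg0 measurableSet_Iio hJ ?_)
      intro σ hσ hσR
      have h := habs hr.1 hσR
      have h0 : r * σ < 0 := mul_neg_of_pos_of_neg hr.1 hσ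
      exact ⟨by linarith [ht.1], by linarith [hr.2]⟩
    · refine (min_le_right _ _).trans (hψ.le_mollify hR hr.1 hg hg0 measurableSet_Ioi hJ ?_)
      intro σ hσ hσR
      have h := habs hr.1 hσR
      have h0 : 0 < r * σ := mul_pos hr.1 hσ
      exact ⟨by linarith [hr.2], by linarith [ht.2]⟩

end IsMollifier

/-! ### Uniform bounds for the regularised coefficients -/

/-- Lets an extension be changed on a null set so that it equals the coefficient at every point of
`[0,T]`; Lipschitz and lower bounds are then available pointwise. -/
theorem ae_eq_piecewise_of_ae_restrict {T : ℝ} {E : Type*} {g g' : ℝ → E}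
    (h : ∀ᵐ t ∂volume.restrict (Icc 0 T), g t = g' t) : g =ᵐ[volume] (Icc 0 T).piecewise g' g := by
  classical
  filter_upwards [(ae_restrict_iff' measurableSet_Icc).1 h] with t ht
  by_cases h0 : t ∈ Icc 0 T
  · rw [piecewise_eq_of_mem _ _ _ h0, ht h0]
  · rw [piecewise_eq_of_notMem _ _ _ h0]

theorem IsScale.tendsto_nhdsGT {r : ℝ → ℝ} (hr : IsScale r) : Tendsto r (𝓝[>] 0) (𝓝[>] 0) :=
  tendsto_nhdsWithin_iff.2 ⟨hr.2, by
    filter_upwards [Ioc_mem_nhdsGT (one_pos (α := ℝ))] with ε hε using hr.1 ε hε⟩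

/-- Uniform bounds for the regularised propagation speeds. -/
theorem IsPositiveRegularisation.exists_bounds {T : ℝ} (hT : 0 < T) {a : ℝ → ℝ} {aε : ℝ → ℝ → ℝ}
    (h : IsPositiveRegularisation T a aε) (ha : MemLInftyOne T a) {a₀ : ℝ} (ha₀ : 0 < a₀)
    (ha_ge : ∀ t ∈ Icc 0 T, a₀ ≤ a t) :
    ∃ c > 0, c ≤ 1 ∧ ∃ M A : ℝ, 0 ≤ M ∧ ∀ᶠ ε in 𝓝[>] (0 : ℝ),
      (∀ t ∈ Icc 0 T, c ≤ aε ε t) ∧ (∀ t, |aε ε t| ≤ M) ∧ ∃ α' : ℝ → ℝ,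
        (∀ t, HasDerivAt (aε ε) (α' t) t) ∧ Continuous α' ∧ ∫ t in (0 : ℝ)..T, |α' t| ≤ A := by
  classical
  obtain ⟨B₀, ψ, r, hB₀, hB₀a, hB₀0, hpos₀, hψ, hr, hmol, -⟩ := h
  obtain ⟨C, hC⟩ := ha
  let B := (Icc 0 T).piecewise a B₀
  have hBB : B₀ =ᵐ[volume] B := ae_eq_piecewise_of_ae_restrict hB₀a
  have hB : MemLp B ∞ volume := hB₀.ae_eq hBB
  have hB0 : ∀ᵐ t, 0 ≤ B t := by
    filter_upwards [hBB, hB₀0] with t h1 h2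
    rwa [← h1]
  have hBa : ∀ t ∈ Icc 0 T, B t = a t := fun t ht => piecewise_eq_of_mem _ _ _ ht
  have hpos : (∃ δ > 0, ∃ α > 0, ∀ᵐ t ∂volume.restrict (Ioo (-δ) (T + δ)), α ≤ B t) ∨
      ((∃ σ < 0, 0 < ψ σ) ∧ ∃ σ > 0, 0 < ψ σ) := by
    refine hpos₀.imp_left ?_
    rintro ⟨δ, hδ, α, hα, h⟩
    refine ⟨δ, hδ, α, hα, ?_⟩
    filter_upwards [h, ae_restrict_of_ae hBB] with t h1 h2
    rwa [← h2]
  have hBC : LipschitzOnWith C B (Icc 0 T) := fun x hx y hy => by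
    rw [hBa x hx, hBa y hy]; exact hC hx hy
  obtain ⟨M, hM0, hM⟩ := ae_norm_le_of_memLp_top hB
  obtain ⟨R, hR0, hR⟩ := hψ.exists_radius
  obtain ⟨c, hc, hlow⟩ := hψ.exists_pos_le_mollify hT hB hB0 ha₀
    (fun t ht => by rw [hBa t ht]; exact ha_ge t ht) hpos
  -- The lower bound is capped at `1` for the energy estimate, where `c` must bound the coefficients
  -- of both `λ |v|²` and `|v|²`.
  refine ⟨min c 1, lt_min hc one_pos, min_le_right _ _, M,
    2 * R * ((∫ σ, |deriv ψ σ|) * M) + C * T, hM0, ?_⟩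
  filter_upwards [hr.tendsto_nhdsGT.eventually hlow, Ioc_mem_nhdsGT (one_pos (α := ℝ)),
    hr.tendsto_nhdsGT.eventually (Ioo_mem_nhdsGT (show 0 < T / 2 / R by positivity))]
    with ε h1 hε hrε
  have he : aε ε = mollify ψ (r ε) B := by rw [hmol ε hε, mollify_congr_ae ψ _ hBB]
  have hrR : r ε * R < T / 2 := (lt_div_iff₀ hR0).1 hrε.2
  have hBl : LocallyIntegrable B := hB.locallyIntegrable le_top
  rw [he]
  exact ⟨fun t ht => (min_le_left _ _).trans (h1 t ht), fun t => hψ.norm_mollify_le hrε.1 hM t,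
    _, hψ.hasDerivAt_mollify hrε.1 hBl, hψ.continuous_mollify_deriv hrε.1 hBl,
    hψ.integral_abs_mollify_deriv_le hR hR0 hrε.1 hB hM hBC (by linarith)⟩

/-- `L¹` convergence of regularisations of bounded functions. -/
theorem tendsto_setLIntegral_enorm_sub_of_mollify {E : Type*} [NormedAddCommGroup E]
    [NormedSpace ℝ E] [CompleteSpace E] {T : ℝ} {g B : ℝ → E} {ψ r : ℝ → ℝ} {gε : ℝ → ℝ → E}
    (hB : LocallyIntegrable B) (hBg : ∀ᵐ t ∂volume.restrict (Icc 0 T), B t = g t)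
    (hψ : IsMollifier ψ) (hr : IsScale r)
    (hg : ∀ ε ∈ Ioc (0 : ℝ) 1, gε ε = mollify ψ (r ε) B) :
    Tendsto (fun ε => ∫⁻ t in Icc 0 T, ‖gε ε t - g t‖ₑ) (𝓝[>] 0) (𝓝 0) := by
  refine ((hψ.tendsto_setLIntegral_enorm_mollify_sub hB T).comp hr.tendsto_nhdsGT).congr' ?_
  filter_upwards [Ioc_mem_nhdsGT (one_pos (α := ℝ))] with ε hε
  refine lintegral_congr_ae (hBg.mono fun t ht => ?_)
  simp only [hg ε hε, ht]

/-- Uniform bounds for regularisations of bounded functions. -/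
theorem IsRegularisation.exists_bounds {m : ℕ} {T : ℝ} {b : ℝ → ℝ} {bε : ℝ → ℝ → ℝ}
    (h : IsRegularisation m T b bε) : ∃ M : ℝ, 0 ≤ M ∧ ∀ ε ∈ Ioc (0 : ℝ) 1,
      (∀ t, |bε ε t| ≤ M) ∧ Continuous (bε ε) := by
  obtain ⟨B, ψ, r, hB, -, hψ, hr, hmol, -⟩ := h
  obtain ⟨M, hM0, hM⟩ := ae_norm_le_of_memLp_top hB
  refine ⟨M, hM0, fun ε hε => ?_⟩
  rw [hmol ε hε]
  exact ⟨fun t => hψ.norm_mollify_le (hr.1 ε hε) hM t,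
    hψ.continuous_mollify (hr.1 ε hε) (hB.locallyIntegrable le_top)⟩

/-! ### Energy and stability estimates for a single mode -/

theorem hasDerivWithinAt_integral_Icc {E : Type*} [NormedAddCommGroup E] [NormedSpace ℝ E]
    [CompleteSpace E] {T : ℝ} {g : ℝ → E} (hg : ContinuousOn g (Icc 0 T)) {t : ℝ}
    (ht : t ∈ Icc 0 T) :
    HasDerivWithinAt (fun x => ∫ τ in (0 : ℝ)..x, g τ) (g t) (Icc 0 T) t := by
  have hT : (0 : ℝ) ≤ T := ht.1.trans ht.2
  have : Fact (t ∈ Icc 0 T) := ⟨ht⟩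
  exact intervalIntegral.integral_hasDerivWithinAt_right
    ((hg.mono (by rw [uIcc_of_le ht.1]; exact Icc_subset_Icc le_rfl ht.2)).intervalIntegrable)
    (hg.stronglyMeasurableAtFilter_nhdsWithin measurableSet_Icc t) (hg t ht)

/-- Energy estimate for `v'' + (λ α + q) v = g`. -/
theorem wave_energy_le {T l c M Q A : ℝ} (hl : 0 ≤ l) (hc : 0 < c)
    (hc1 : c ≤ 1) (hQ : 0 ≤ Q) {v v' g : ℝ → ℂ} {α α' q : ℝ → ℝ}
    (hv : ∀ t ∈ Icc 0 T, HasDerivWithinAt v (v' t) (Icc 0 T) t)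
    (hv' : ∀ t ∈ Icc 0 T, HasDerivWithinAt v' (g t - α t * (l * v t) - q t * v t) (Icc 0 T) t)
    (hα : ∀ t, HasDerivAt α (α' t) t) (hα' : Continuous α') (hg : Continuous g)
    (hq : ∀ t ∈ Icc 0 T, |q t| ≤ Q) (hcα : ∀ t ∈ Icc 0 T, c ≤ α t) (hαM : α 0 ≤ M)
    (hA : ∫ t in (0 : ℝ)..T, |α' t| ≤ A) {t : ℝ} (ht : t ∈ Icc 0 T) :
    c * (1 + l) * ‖v t‖ ^ 2 ≤ Real.exp ((2 + Q) * T + A / c) *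
      (‖v' 0‖ ^ 2 + (l * M + 1) * ‖v 0‖ ^ 2 + ∫ τ in (0 : ℝ)..T, ‖g τ‖ ^ 2) := by
  have hT : 0 ≤ T := ht.1.trans ht.2
  -- The extra `1` in front of `|v|²` keeps the energy coercive when `l` is small or zero.
  let E : ℝ → ℝ := fun t => ‖v' t‖ ^ 2 + (l * α t + 1) * ‖v t‖ ^ 2
  -- The growth rate of `E`: `1 + Q` for the lower order terms, `1` for the source, and `|α'| / c`
  -- for `l α' |v|²`, which is compared with `l α |v|²` through `c ≤ α`.
  let β : ℝ → ℝ := fun t => (2 + Q) + |α' t| / c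
  let B : ℝ → ℝ := fun t => ∫ τ in (0 : ℝ)..t, β τ
  let G : ℝ → ℝ := fun t => ∫ τ in (0 : ℝ)..t, ‖g τ‖ ^ 2
  have hβc : Continuous β := by fun_prop
  have hβ0 : ∀ t, 0 ≤ β t := fun t => by positivity
  have hgc : Continuous fun τ => ‖g τ‖ ^ 2 := by fun_prop
  have hB : ∀ t, HasDerivAt B (β t) t := fun t => hβc.integral_hasStrictDerivAt 0 t |>.hasDerivAt
  have hG : ∀ t, HasDerivAt G (‖g t‖ ^ 2) t :=
    fun t => hgc.integral_hasStrictDerivAt 0 t |>.hasDerivAt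
  have hB0 : ∀ t ∈ Icc 0 T, 0 ≤ B t := fun t ht =>
    intervalIntegral.integral_nonneg ht.1 fun x _ => hβ0 x
  let E' : ℝ → ℝ := fun t => 2 * inner ℝ (v' t) (g t - α t * (l * v t) - q t * v t) +
    (l * α' t * ‖v t‖ ^ 2 + (l * α t + 1) * (2 * inner ℝ (v t) (v' t)))
  have hE : ∀ t ∈ Icc 0 T, HasDerivWithinAt E (E' t) (Icc 0 T) t := fun t ht => by
    have h1 := (hv' t ht).norm_sq
    have h2 := ((((hα t).const_mul l).add_const 1).hasDerivWithinAt (s := Icc 0 T)).mul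
      (hv t ht).norm_sq
    exact h1.add h2
  have hlower : ∀ t ∈ Icc 0 T, 0 ≤ l * (α t - c) := fun t ht =>
    mul_nonneg hl (sub_nonneg.2 (hcα t ht))
  have hE' : ∀ t ∈ Icc 0 T, E' t ≤ β t * E t + ‖g t‖ ^ 2 := fun t ht => by
    have hin : inner ℝ (v' t) (g t - α t * (l * v t) - q t * v t) =
        inner ℝ (v' t) (g t) - (l * α t + q t) * inner ℝ (v t) (v' t) := by
      have : g t - α t * (l * v t) - q t * v t = g t - (l * α t + q t) • v t := by
        rw [Complex.real_smul]; push_cast; ring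
      rw [this, inner_sub_right, inner_smul_right, real_inner_comm (v' t) (v t)]
    have e1 : 2 * inner ℝ (v' t) (g t) ≤ ‖v' t‖ ^ 2 + ‖g t‖ ^ 2 := by
      have := real_inner_le_norm (v' t) (g t)
      nlinarith [sq_nonneg (‖v' t‖ - ‖g t‖)]
    -- The terms `2 l α ⟨v, v'⟩` from the equation and from the weight cancel, so the remaining
    -- coefficient `1 - q` does not grow with `l`.
    have e2 : 2 * (1 - q t) * inner ℝ (v t) (v' t) ≤ (1 + Q) * (‖v t‖ ^ 2 + ‖v' t‖ ^ 2) := by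
      have h1 := abs_real_inner_le_norm (v t) (v' t)
      have h2 : |1 - q t| ≤ 1 + Q := (abs_sub _ _).trans (by simpa using hq t ht)
      calc 2 * (1 - q t) * inner ℝ (v t) (v' t) ≤ |2 * (1 - q t) * inner ℝ (v t) (v' t)| :=
            le_abs_self _
        _ = 2 * (|1 - q t| * |inner ℝ (v t) (v' t)|) := by
            rw [abs_mul, abs_mul, abs_two, mul_assoc]
        _ ≤ 2 * ((1 + Q) * (‖v t‖ * ‖v' t‖)) := by gcongr
        _ ≤ _ := by nlinarith [sq_nonneg (‖v t‖ - ‖v' t‖)]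
    have e3 : l * α' t * ‖v t‖ ^ 2 ≤ |α' t| / c * (l * α t * ‖v t‖ ^ 2) := by
      have h0 : 0 ≤ |α' t| / c := by positivity
      have h1 : |α' t| = |α' t| / c * c := (div_mul_cancel₀ _ hc.ne').symm
      calc l * α' t * ‖v t‖ ^ 2 ≤ l * |α' t| * ‖v t‖ ^ 2 := by gcongr; exact le_abs_self _
        _ = |α' t| / c * (l * c * ‖v t‖ ^ 2) := by rw [h1]; field_simp
        _ ≤ _ := by
          refine mul_le_mul_of_nonneg_left ?_ h0
          nlinarith [hlower t ht, sq_nonneg ‖v t‖]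
    have hnn : 0 ≤ l * α t * ‖v t‖ ^ 2 := by
      have := hcα t ht
      have : 0 ≤ α t := hc.le.trans this
      positivity
    have e4 : |α' t| / c * (l * α t * ‖v t‖ ^ 2) ≤ |α' t| / c * E t := by
      refine mul_le_mul_of_nonneg_left ?_ (by positivity)
      simp only [E]
      nlinarith [sq_nonneg ‖v t‖, sq_nonneg ‖v' t‖]
    have e5 : (1 + Q) * (‖v t‖ ^ 2 + ‖v' t‖ ^ 2) + ‖v' t‖ ^ 2 ≤ (2 + Q) * E t := by
      simp only [E]
      nlinarith [sq_nonneg ‖v t‖, sq_nonneg ‖v' t‖, mul_nonneg hQ hnn]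
    simp only [E', β]
    rw [hin]
    linarith
  -- Grönwall with a variable rate: the integrating factor is at most `1`, so the source enters only
  -- through its squared `L²` norm.
  have hanti : AntitoneOn (fun t => Real.exp (-B t) * E t - G t) (Icc 0 T) := by
    have hder : ∀ t ∈ Icc 0 T, HasDerivWithinAt (fun t => Real.exp (-B t) * E t - G t)
        (Real.exp (-B t) * -β t * E t + Real.exp (-B t) * E' t - ‖g t‖ ^ 2) (Icc 0 T) t :=
      fun t ht => (((hB t).neg.exp.hasDerivWithinAt).mul (hE t ht)).sub (hG t).hasDerivWithinAt
    refine antitoneOn_of_hasDerivWithinAt_nonpos (convex_Icc 0 T)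
      (fun t ht => (hder t ht).continuousWithinAt)
      (fun t ht => (hder t (interior_subset ht)).mono interior_subset) fun t ht => ?_
    have ht' := interior_subset ht
    have h1 : Real.exp (-B t) ≤ 1 := Real.exp_le_one_iff.2 (neg_nonpos.2 (hB0 t ht'))
    have h2 := mul_le_mul_of_nonneg_left (hE' t ht') (Real.exp_pos (-B t)).le
    have h3 := mul_le_mul_of_nonneg_right h1 (sq_nonneg ‖g t‖)
    linarith
  have hmain := hanti (left_mem_Icc.2 hT) ht ht.1
  have hB00 : B 0 = 0 := intervalIntegral.integral_same
  have hG00 : G 0 = 0 := intervalIntegral.integral_same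
  simp only [hB00, hG00, neg_zero, Real.exp_zero, one_mul, sub_zero] at hmain
  have hGT : G t ≤ G T := by
    refine intervalIntegral.integral_mono_interval le_rfl ht.1 ht.2
      (Eventually.of_forall fun _ => by positivity) (hgc.intervalIntegrable _ _)
  have hBT : B t ≤ (2 + Q) * T + A / c := by
    have h1 : B t ≤ B T := intervalIntegral.integral_mono_interval le_rfl ht.1 ht.2
      (Eventually.of_forall hβ0) (hβc.intervalIntegrable _ _)
    have h2 : B T = (2 + Q) * T + (∫ t in (0 : ℝ)..T, |α' t|) / c := by
      simp only [B, β]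
      rw [intervalIntegral.integral_add (continuous_const.intervalIntegrable _ _)
        ((by fun_prop : Continuous fun t => |α' t| / c).intervalIntegrable _ _),
        intervalIntegral.integral_div, intervalIntegral.integral_const, smul_eq_mul]
      ring
    rw [h2] at h1
    refine h1.trans ?_
    gcongr
  have hE0 : E 0 ≤ ‖v' 0‖ ^ 2 + (l * M + 1) * ‖v 0‖ ^ 2 := by
    simp only [E]; gcongr
  have hEt : E t ≤ Real.exp (B t) * (E 0 + G T) := by
    have h1 : Real.exp (-B t) * E t ≤ E 0 + G T := by linarith
    have h2 := mul_le_mul_of_nonneg_left h1 (Real.exp_pos (B t)).le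
    rwa [← mul_assoc, ← Real.exp_add, add_neg_cancel, Real.exp_zero, one_mul] at h2
  have hEnn : 0 ≤ E 0 + G T := by
    have h1 : 0 ≤ G T := intervalIntegral.integral_nonneg hT fun x _ => by positivity
    have h2 : 0 ≤ E 0 := by
      have := hlower 0 (left_mem_Icc.2 hT)
      have : 0 ≤ l * α 0 := by nlinarith
      simp only [E]; positivity
    linarith
  -- Here `c ≤ α` handles the term with `l`, and `c ≤ 1` the other one.
  calc c * (1 + l) * ‖v t‖ ^ 2 ≤ E t := by
        have := hlower t ht
        simp only [E]
        nlinarith [sq_nonneg ‖v t‖, sq_nonneg ‖v' t‖]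
    _ ≤ Real.exp (B t) * (E 0 + G T) := hEt
    _ ≤ _ := by
        refine mul_le_mul (Real.exp_le_exp.2 hBT) ?_ hEnn (Real.exp_pos _).le
        exact add_le_add hE0 le_rfl

/-- Stability for a second order Cauchy problem with small source. -/
theorem norm_le_of_second_order {T δ P : ℝ} (hδ : 0 ≤ δ) (hP : 0 ≤ P) {w d : ℝ → ℂ}
    (hw0 : w 0 = 0) (hw : ∀ t ∈ Icc 0 T, HasDerivWithinAt w (d t) (Icc 0 T) t)
    (hd : ∀ t ∈ Icc 0 T, ‖d t‖ ≤ δ + P * ∫ τ in (0 : ℝ)..t, ‖w τ‖) {t : ℝ} (ht : t ∈ Icc 0 T) :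
    ‖w t‖ ≤ T * δ + T * P * gronwallBound 0 (T * P) (T * δ) T := by
  have hT : 0 ≤ T := ht.1.trans ht.2
  have hwc : ContinuousOn w (Icc 0 T) := fun t ht => (hw t ht).continuousWithinAt
  -- Since `y` is increasing, the bound on `d` up to time `t` is governed by `y t`; the mean value
  -- inequality then bounds `y' = ‖w‖` by an affine function of `y`.
  let y : ℝ → ℝ := fun t => ∫ τ in (0 : ℝ)..t, ‖w τ‖
  have hy : ∀ t ∈ Icc 0 T, HasDerivWithinAt y ‖w t‖ (Icc 0 T) t := fun t ht =>
    hasDerivWithinAt_integral_Icc hwc.norm ht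
  have hy0 : ∀ t ∈ Icc 0 T, 0 ≤ y t := fun t ht =>
    intervalIntegral.integral_nonneg ht.1 fun x _ => norm_nonneg _
  have hmono : ∀ t ∈ Icc 0 T, ∀ τ ∈ Icc 0 t, y τ ≤ y t := fun t ht τ hτ => by
    refine intervalIntegral.integral_mono_interval le_rfl hτ.1 hτ.2
      (Eventually.of_forall fun _ => norm_nonneg _) ?_
    refine (hwc.norm.mono ?_).intervalIntegrable
    rw [uIcc_of_le ht.1]
    exact Icc_subset_Icc le_rfl ht.2
  have hwy : ∀ t ∈ Icc 0 T, ‖w t‖ ≤ T * δ + T * P * y t := fun t ht => by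
    have hsub : Icc 0 t ⊆ Icc 0 T := Icc_subset_Icc le_rfl ht.2
    have h := Convex.norm_image_sub_le_of_norm_hasDerivWithin_le (C := δ + P * y t)
      (fun x hx => (hw x (hsub hx)).mono hsub)
      (fun x hx => (hd x (hsub hx)).trans
        (add_le_add le_rfl (mul_le_mul_of_nonneg_left (hmono t ht x hx) hP)))
      (convex_Icc 0 t) (left_mem_Icc.2 ht.1) (right_mem_Icc.2 ht.1)
    rw [hw0, sub_zero, sub_zero, Real.norm_eq_abs, abs_of_nonneg ht.1] at h
    have h1 : 0 ≤ δ + P * y t := add_nonneg hδ (mul_nonneg hP (hy0 t ht))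
    calc ‖w t‖ ≤ (δ + P * y t) * t := h
      _ ≤ (δ + P * y t) * T := mul_le_mul_of_nonneg_left ht.2 h1
      _ = _ := by ring
  have hgr : y t ≤ gronwallBound 0 (T * P) (T * δ) t := by
    have h := norm_le_gronwallBound_of_norm_deriv_right_le (f := y) (f' := fun t => ‖w t‖)
      (δ := 0) (K := T * P) (ε := T * δ) (a := 0) (b := T)
      (fun t ht => (hy t ht).continuousWithinAt)
      (fun t ht => ((hy t (Ico_subset_Icc_self ht)).mono_of_mem_nhdsWithin
        (Icc_mem_nhdsGE_of_mem ht)))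
      (by simp [y])
      (fun t ht => by
        have ht' := Ico_subset_Icc_self ht
        rw [norm_norm, Real.norm_eq_abs, abs_of_nonneg (hy0 t ht')]
        linarith [hwy t ht']) t ht
    rw [sub_zero] at h
    exact (le_abs_self _).trans h
  have hgm := gronwallBound_mono (le_refl (0 : ℝ)) (mul_nonneg hT hδ) (mul_nonneg hT hP) ht.2
  refine (hwy t ht).trans (add_le_add le_rfl (mul_le_mul_of_nonneg_left (hgr.trans hgm)
    (mul_nonneg hT hP)))

/-- `v` solves `v'' + a l v + q v = f`, `v(0) = z₀`, `v'(0) = z₁` on `[0,T]`, in integrated form. -/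
structure IsModeSolution (T l : ℝ) (a q : ℝ → ℝ) (f : ℝ → ℂ) (z₀ z₁ : ℂ) (v v' : ℝ → ℂ) :
    Prop where
  init : v 0 = z₀
  init_deriv : v' 0 = z₁
  hasDeriv : ∀ t ∈ Icc 0 T, HasDerivWithinAt v (v' t) (Icc 0 T) t
  integrable : IntegrableOn (fun τ => f τ - a τ * (l * v τ) - q τ * v τ) (Icc 0 T)
  deriv_eq : ∀ t ∈ Icc 0 T, v' t = z₁ + ∫ τ in (0 : ℝ)..t, (f τ - a τ * (l * v τ) - q τ * v τ)

namespace IsModeSolution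

variable {T l : ℝ} {a q : ℝ → ℝ} {f : ℝ → ℂ} {z₀ z₁ : ℂ} {v v' : ℝ → ℂ}

theorem continuousOn (h : IsModeSolution T l a q f z₀ z₁ v v') : ContinuousOn v (Icc 0 T) :=
  fun t ht => (h.hasDeriv t ht).continuousWithinAt

/-- Continuity of the coefficients and the source allows the integrated equation to be
differentiated at every time, so the classical energy argument applies to the regularised problems.
-/
theorem energy_le (h : IsModeSolution T l a q f z₀ z₁ v v') {c M Q A : ℝ} {α' : ℝ → ℝ}
    (hl : 0 ≤ l) (hc : 0 < c) (hc1 : c ≤ 1) (hQ : 0 ≤ Q) (ha : ∀ t, HasDerivAt a (α' t) t)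
    (hα' : Continuous α') (hqc : Continuous q) (hf : Continuous f) (hq : ∀ t, |q t| ≤ Q)
    (hca : ∀ t ∈ Icc 0 T, c ≤ a t) (haM : a 0 ≤ M) (hA : ∫ t in (0 : ℝ)..T, |α' t| ≤ A)
    {t : ℝ} (ht : t ∈ Icc 0 T) :
    c * (1 + l) * ‖v t‖ ^ 2 ≤ Real.exp ((2 + Q) * T + A / c) *
      (‖z₁‖ ^ 2 + (l * M + 1) * ‖z₀‖ ^ 2 + ∫ τ in (0 : ℝ)..T, ‖f τ‖ ^ 2) := by
  have hac : Continuous a := continuous_iff_continuousAt.2 fun t => (ha t).continuousAt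
  have hv' : ∀ t ∈ Icc 0 T,
      HasDerivWithinAt v' (f t - a t * (l * v t) - q t * v t) (Icc 0 T) t := fun t ht => by
    have hcont : ContinuousOn (fun τ => f τ - a τ * (l * v τ) - q τ * v τ) (Icc 0 T) := by
      have := h.continuousOn
      fun_prop
    exact ((hasDerivWithinAt_integral_Icc hcont ht).const_add z₁).congr h.deriv_eq
      (h.deriv_eq t ht)
  have := wave_energy_le hl hc hc1 hQ h.hasDeriv hv' ha hα' hf (fun t _ => hq t) hca haM hA ht
  rwa [h.init, h.init_deriv] at this

/-- Continuous dependence of the solution on the coefficients and the source. -/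
theorem norm_sub_le (h : IsModeSolution T l a q f z₀ z₁ v v') {b p : ℝ → ℝ} {g : ℝ → ℂ}
    {w w' : ℝ → ℂ} (h' : IsModeSolution T l b p g z₀ z₁ w w') (hl : 0 ≤ l) {M Q V δ : ℝ}
    (hM0 : 0 ≤ M) (hQ0 : 0 ≤ Q) (hV0 : 0 ≤ V) (hδ0 : 0 ≤ δ)
    (hM : ∀ t ∈ Icc 0 T, |b t| ≤ M) (hQ : ∀ t ∈ Icc 0 T, |p t| ≤ Q)
    (hV : ∀ t ∈ Icc 0 T, ‖v t‖ ≤ V)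
    (hma : AEStronglyMeasurable (fun t => b t - a t) (volume.restrict (Icc 0 T)))
    (hmq : AEStronglyMeasurable (fun t => p t - q t) (volume.restrict (Icc 0 T)))
    (hδ : (∫⁻ t in Icc 0 T, ‖g t - f t‖ₑ) + ENNReal.ofReal (l * V) * (∫⁻ t in Icc 0 T, ‖b t - a t‖ₑ)
      + ENNReal.ofReal V * (∫⁻ t in Icc 0 T, ‖p t - q t‖ₑ) ≤ ENNReal.ofReal δ)
    {t : ℝ} (ht : t ∈ Icc 0 T) :
    ‖w t - v t‖ ≤ T * δ + T * (l * M + Q) * gronwallBound 0 (T * (l * M + Q)) (T * δ) T := by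
  have hP : 0 ≤ l * M + Q := by positivity
  refine norm_le_of_second_order (d := fun t => w' t - v' t) hδ0 hP
    (by simp [h.init, h'.init]) (fun t ht => (h'.hasDeriv t ht).sub (h.hasDeriv t ht)) ?_ ht
  intro t ht
  have hsub : Icc 0 t ⊆ Icc 0 T := Icc_subset_Icc le_rfl ht.2
  have hi : IntervalIntegrable (fun τ => f τ - a τ * (l * v τ) - q τ * v τ) volume 0 t :=
    (intervalIntegrable_iff_integrableOn_Icc_of_le ht.1).2 (h.integrable.mono_set hsub)
  have hi' : IntervalIntegrable (fun τ => g τ - b τ * (l * w τ) - p τ * w τ) volume 0 t :=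
    (intervalIntegrable_iff_integrableOn_Icc_of_le ht.1).2 (h'.integrable.mono_set hsub)
  have hwv : ContinuousOn (fun τ => w τ - v τ) (Icc 0 t) :=
    (h'.continuousOn.sub h.continuousOn).mono hsub
  have hwi : IntegrableOn (fun τ => w τ - v τ) (Icc 0 t) := hwv.integrableOn_Icc
  have hPw : ∫⁻ τ in Icc 0 t, ENNReal.ofReal (l * M + Q) * ‖w τ - v τ‖ₑ =
      ENNReal.ofReal ((l * M + Q) * ∫ τ in (0 : ℝ)..t, ‖w τ - v τ‖) := by
    rw [lintegral_const_mul'' _ hwi.1.enorm, ENNReal.ofReal_mul hP,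
      intervalIntegral.integral_of_le ht.1, ← integral_Icc_eq_integral_Ioc,
      ofReal_integral_norm_eq_lintegral_enorm hwi]
  have hint0 : 0 ≤ ∫ τ in (0 : ℝ)..t, ‖w τ - v τ‖ :=
    intervalIntegral.integral_nonneg ht.1 fun x _ => norm_nonneg _
  have hd : w' t - v' t = ∫ τ in Icc 0 t, ((g τ - b τ * (l * w τ) - p τ * w τ) -
      (f τ - a τ * (l * v τ) - q τ * v τ)) := by
    rw [h'.deriv_eq t ht, h.deriv_eq t ht, add_sub_add_left_eq_sub,
      ← intervalIntegral.integral_sub hi' hi, intervalIntegral.integral_of_le ht.1,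
      integral_Icc_eq_integral_Ioc]
  have hle : volume.restrict (Icc 0 t) ≤ volume.restrict (Icc 0 T) :=
    Measure.restrict_mono hsub le_rfl
  have hlV : 0 ≤ l * V := by positivity
  have key : ‖w' t - v' t‖ₑ ≤
      ENNReal.ofReal (δ + (l * M + Q) * ∫ τ in (0 : ℝ)..t, ‖w τ - v τ‖) := by
    calc ‖w' t - v' t‖ₑ
        ≤ ∫⁻ τ in Icc 0 t, ‖(g τ - b τ * (l * w τ) - p τ * w τ) -
            (f τ - a τ * (l * v τ) - q τ * v τ)‖ₑ := by
          rw [hd]; exact enorm_integral_le_lintegral_enorm _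
      _ ≤ ∫⁻ τ in Icc 0 t, (‖g τ - f τ‖ₑ + ENNReal.ofReal (l * V) * ‖b τ - a τ‖ₑ
            + ENNReal.ofReal V * ‖p τ - q τ‖ₑ + ENNReal.ofReal (l * M + Q) * ‖w τ - v τ‖ₑ) := by
          refine setLIntegral_mono' measurableSet_Icc fun τ hτ => ?_
          have hτ' := hsub hτ
          simp only [← ofReal_norm]
          rw [← ENNReal.ofReal_mul hlV, ← ENNReal.ofReal_mul hV0, ← ENNReal.ofReal_mul hP,
            ← ENNReal.ofReal_add (by positivity) (by positivity),
            ← ENNReal.ofReal_add (by positivity) (by positivity),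
            ← ENNReal.ofReal_add (by positivity) (by positivity)]
          refine ENNReal.ofReal_le_ofReal ?_
          -- The coefficient errors multiply `v`, which has the bound `V`, so their `L¹` norms
          -- suffice. The factor `w - v`, left for Grönwall, carries the bounded coefficients `b`
          -- and `p`.
          have e : (g τ - b τ * (l * w τ) - p τ * w τ) - (f τ - a τ * (l * v τ) - q τ * v τ) =
              (g τ - f τ) - ((b τ - a τ : ℝ) : ℂ) * (l * v τ) - ((p τ - q τ : ℝ) : ℂ) * v τ
                - ((l * b τ + p τ : ℝ) : ℂ) * (w τ - v τ) := by
            push_cast; ring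
          have n1 : ‖((b τ - a τ : ℝ) : ℂ) * (l * v τ)‖ ≤ l * V * ‖b τ - a τ‖ := by
            rw [norm_mul, norm_mul, Complex.norm_real, Complex.norm_real, Real.norm_of_nonneg hl,
              mul_comm]
            gcongr
            exact hV τ hτ'
          have n2 : ‖((p τ - q τ : ℝ) : ℂ) * v τ‖ ≤ V * ‖p τ - q τ‖ := by
            rw [norm_mul, Complex.norm_real, mul_comm]
            gcongr
            exact hV τ hτ'
          have n3 : ‖((l * b τ + p τ : ℝ) : ℂ) * (w τ - v τ)‖ ≤ (l * M + Q) * ‖w τ - v τ‖ := by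
            rw [norm_mul, Complex.norm_real]
            gcongr
            refine (norm_add_le _ _).trans (add_le_add ?_ (hQ τ hτ'))
            rw [norm_mul, Real.norm_of_nonneg hl]
            exact mul_le_mul_of_nonneg_left (hM τ hτ') hl
          rw [e]
          refine (_root_.norm_sub_le _ _).trans (add_le_add ((_root_.norm_sub_le _ _).trans
            (add_le_add ((_root_.norm_sub_le _ _).trans (add_le_add le_rfl n1)) n2)) n3)
      _ = ((∫⁻ τ in Icc 0 t, ‖g τ - f τ‖ₑ) + ENNReal.ofReal (l * V) * (∫⁻ τ in Icc 0 t, ‖b τ - a τ‖ₑ)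
            + ENNReal.ofReal V * (∫⁻ τ in Icc 0 t, ‖p τ - q τ‖ₑ))
            + ∫⁻ τ in Icc 0 t, ENNReal.ofReal (l * M + Q) * ‖w τ - v τ‖ₑ := by
          have m1 := (hma.mono_measure hle).enorm
          have m2 := (hmq.mono_measure hle).enorm
          -- Additivity is applied by splitting off the right summand each time, so `g - f` need not
          -- be measurable.
          rw [lintegral_add_right' _ (hwi.1.enorm.const_mul _),
            lintegral_add_right' _ (m2.const_mul _), lintegral_add_right' _ (m1.const_mul _),
            lintegral_const_mul'' _ m1, lintegral_const_mul'' _ m2]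
      _ ≤ ENNReal.ofReal δ + ENNReal.ofReal ((l * M + Q) * ∫ τ in (0 : ℝ)..t, ‖w τ - v τ‖) := by
          rw [hPw]
          refine add_le_add (le_trans ?_ hδ) le_rfl
          gcongr
      _ = _ := (ENNReal.ofReal_add hδ0 (mul_nonneg hP hint0)).symm
  rw [← ofReal_norm] at key
  exact (ENNReal.ofReal_le_ofReal_iff (add_nonneg hδ0 (mul_nonneg hP hint0))).1 key

end IsModeSolution

/-! ### Fourier coefficients and Sobolev norms -/

namespace DiscreteSchrodinger

variable {n : ℕ} (S : DiscreteSchrodinger n)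

theorem countable_pt : Countable S.Pt := by
  have hinj : Function.Injective fun k : S.Pt => (k.2.choose : Fin n → ℤ) := by
    intro x y hxy
    apply Subtype.ext
    ext i
    rw [x.2.choose_spec i, y.2.choose_spec i]
    exact congrArg (fun k : Fin n → ℤ => S.h * (k i : ℝ)) hxy
  exact hinj.countable

/-- By Bessel's inequality a point mass has only countably many nonzero coefficients, and each
eigenfunction is nonzero at one of the countably many lattice points. Countability is what permits
exchanging the sum over `ξ` with the time integral. -/
theorem countable_freq : Countable S.Freq := by
  classical
  have := S.countable_pt
  let b := S.eigenBasis.basis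
  have hk : ∀ k : S.Pt, {ξ : S.Freq | b ξ k ≠ 0}.Countable := fun k => by
    have hs := b.orthonormal.inner_products_summable (x := (lp.single 2 k (1 : ℂ) : EllTwo S.Pt))
    refine hs.countable_support.mono fun ξ hξ => ?_
    rw [Function.mem_support]
    have h1 : inner ℂ (b ξ) (lp.single 2 k (1 : ℂ) : EllTwo S.Pt) = star (b ξ k) := by
      rw [lp.inner_single_right]
      simp
    rw [h1]
    simpa using hξ
  have huniv : (univ : Set S.Freq) ⊆ ⋃ k : S.Pt, {ξ | b ξ k ≠ 0} := fun ξ _ => by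
    by_contra h
    simp only [mem_iUnion, not_exists, mem_ofPred_eq, not_not] at h
    exact b.orthonormal.ne_zero ξ (by ext k; exact h k)
  exact countable_univ_iff.1 ((countable_iUnion hk).mono huniv)

theorem eig_nonneg (ξ : S.Freq) : 0 ≤ S.eig ξ := S.eigenBasis.eig_nonneg ξ

theorem one_add_eig_pos (ξ : S.Freq) : 0 < 1 + S.eig ξ := by linarith [S.eig_nonneg ξ]

theorem hamTest_eigTest (ξ : S.Freq) : S.hamTest (S.eigTest ξ) = (S.eig ξ : ℂ) • S.eigTest ξ :=
  Subtype.ext (S.eigenBasis.eigen ξ)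

theorem pair_hamTest_eigTest (w : S.Distr) (ξ : S.Freq) :
    S.pair w (S.hamTest (S.eigTest ξ)) = S.eig ξ * S.coeff w ξ := by
  rw [hamTest_eigTest, pair, LinearMap.map_smulₛₗ, Complex.conj_ofReal, smul_eq_mul]
  rfl

theorem coeff_sub (v w : S.Distr) (ξ : S.Freq) : S.coeff (v - w) ξ = S.coeff v ξ - S.coeff w ξ := by
  simp [coeff, pair]

/-- Testing with `u_ξ` turns `H` into multiplication by its real eigenvalue, on which
conjugate-linearity has no effect. -/
theorem SolvesCauchy.isModeSolution {T : ℝ} {a q : ℝ → ℝ} {f : ℝ → S.Distr} {u₀ u₁ : S.Distr}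
    {u : ℝ → S.Distr} (h : S.SolvesCauchy T a q f u₀ u₁ u) (ξ : S.Freq) :
    ∃ v' : ℝ → ℂ, IsModeSolution T (S.eig ξ) a q (fun t => S.coeff (f t) ξ) (S.coeff u₀ ξ)
      (S.coeff u₁ ξ) (fun t => S.coeff (u t) ξ) v' := by
  obtain ⟨u', h0, h1, h⟩ := h
  obtain ⟨hd, hi, he⟩ := h (S.eigTest ξ)
  simp only [pair_hamTest_eigTest] at hi he
  exact ⟨fun t => S.coeff (u' t) ξ, by rw [h0], by rw [h1], hd, hi, he⟩

theorem ofReal_weight_mul (s : ℝ) (ξ : S.Freq) (z : ℂ) :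
    ENNReal.ofReal ((1 + S.eig ξ) ^ s * ‖z‖ ^ 2) =
      ENNReal.ofReal ((1 + S.eig ξ) ^ s) * ‖z‖ₑ ^ (2 : ℝ) := by
  rw [ENNReal.ofReal_mul (Real.rpow_nonneg (S.one_add_eig_pos ξ).le s),
    ENNReal.ofReal_pow (norm_nonneg _), ofReal_norm]
  norm_cast

theorem sobNorm_sq (s : ℝ) (w : S.Distr) : S.sobNorm s w ^ (2 : ℝ) =
    ∑' ξ, ENNReal.ofReal ((1 + S.eig ξ) ^ s * ‖S.coeff w ξ‖ ^ 2) := by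
  rw [sobNorm, ← ENNReal.rpow_mul]
  norm_num

theorem MemSob.tsum_lt_top {s : ℝ} {w : S.Distr} (h : S.MemSob s w) :
    ∑' ξ, ENNReal.ofReal ((1 + S.eig ξ) ^ s * ‖S.coeff w ξ‖ ^ 2) < ∞ := by
  rw [← sobNorm_sq]
  exact ENNReal.rpow_lt_top_of_nonneg (by norm_num) h.ne

/-- Tonelli for the countable set of frequencies: the norm becomes a weighted sum of `L²` norms in
time, which can be estimated mode by mode. -/
theorem l2SobNorm_sq (J : Set ℝ) (s : ℝ) (f : ℝ → S.Distr)
    (hf : ∀ ξ, AEStronglyMeasurable (fun t => S.coeff (f t) ξ) (volume.restrict J)) :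
    S.l2SobNorm J s f ^ (2 : ℝ) =
      ∑' ξ, ENNReal.ofReal ((1 + S.eig ξ) ^ s) * ∫⁻ t in J, ‖S.coeff (f t) ξ‖ₑ ^ (2 : ℝ) := by
  have := S.countable_freq
  have hm : ∀ ξ, AEMeasurable (fun t => ‖S.coeff (f t) ξ‖ₑ ^ (2 : ℝ)) (volume.restrict J) :=
    fun ξ => (hf ξ).enorm.pow_const _
  rw [l2SobNorm, ← ENNReal.rpow_mul]
  simp only [sobNorm_sq, ofReal_weight_mul]
  rw [lintegral_tsum fun ξ => (hm ξ).const_mul _]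
  simp only [lintegral_const_mul'' _ (hm _)]
  norm_num

theorem MemL2Sob.tsum_lt_top {J : Set ℝ} {s : ℝ} {f : ℝ → S.Distr} (h : S.MemL2Sob J s f) :
    ∑' ξ, ENNReal.ofReal ((1 + S.eig ξ) ^ s) * ∫⁻ t in J, ‖S.coeff (f t) ξ‖ₑ ^ (2 : ℝ) < ∞ := by
  rw [← S.l2SobNorm_sq J s f h.1]
  exact ENNReal.rpow_lt_top_of_nonneg (by norm_num) h.2.ne

/-- Each term of a finite sum with strictly positive weights has a finite integral. -/
theorem MemL2Sob.coeff_memLp {J : Set ℝ} {s : ℝ} {f : ℝ → S.Distr} (h : S.MemL2Sob J s f)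
    (ξ : S.Freq) : MemLp (fun t => S.coeff (f t) ξ) 2 (volume.restrict J) := by
  refine ⟨h.1 ξ, ?_⟩
  have h1 := (ENNReal.le_tsum ξ).trans_lt (MemL2Sob.tsum_lt_top S h)
  have hw : ENNReal.ofReal ((1 + S.eig ξ) ^ s) ≠ 0 := by
    rw [Ne, ENNReal.ofReal_eq_zero, not_le]
    exact Real.rpow_pos_of_pos (S.one_add_eig_pos ξ) s
  have h2 : ∫⁻ t in J, ‖S.coeff (f t) ξ‖ₑ ^ (2 : ℝ) < ∞ := by
    by_contra hcon
    rw [not_lt, top_le_iff] at hcon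
    rw [hcon, ENNReal.mul_top hw] at h1
    exact lt_irrefl _ h1
  rw [eLpNorm_lt_top_iff_lintegral_rpow_enorm_lt_top (by norm_num) (by norm_num)]
  simpa using h2

end DiscreteSchrodinger

/-! ### Majorant and convergence of the modes -/

namespace DiscreteSchrodinger

variable {n : ℕ} (S : DiscreteSchrodinger n)

/-- The regularised source, mode by mode: continuity, a uniform `L²` bound, and convergence. -/
theorem IsSourceRegularisation.exists_mode {T s : ℝ} {f : ℝ → S.Distr} {fε : ℝ → ℝ → S.Distr}
    (h : S.IsSourceRegularisation T s f fε) :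
    ∃ N : S.Freq → ℝ≥0∞, ∑' ξ, ENNReal.ofReal ((1 + S.eig ξ) ^ s) * N ξ ≠ ∞ ∧ ∀ ξ,
      (∀ ε ∈ Ioc (0 : ℝ) 1, Continuous (fun t => S.coeff (fε ε t) ξ) ∧
        ∫⁻ t, ‖S.coeff (fε ε t) ξ‖ₑ ^ (2 : ℝ) ≤ N ξ) ∧
      Tendsto (fun ε => ∫⁻ t in Icc 0 T, ‖S.coeff (fε ε t) ξ - S.coeff (f t) ξ‖ₑ) (𝓝[>] 0)
        (𝓝 0) := by
  obtain ⟨F, ψ, r, hF, hFf, hψ, hr, hmol, -⟩ := h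
  have hsum := MemL2Sob.tsum_lt_top S hF
  simp only [Measure.restrict_univ] at hsum
  -- The majorant is the squared `L²(ℝ)` norm of the mode of the extension `F`: summable because `F`
  -- lies in `L²(ℝ; H^s)`, and valid for every `ε` by Young's inequality.
  refine ⟨_, hsum.ne, fun ξ => ?_⟩
  have hFξ := MemL2Sob.coeff_memLp S hF ξ
  rw [Measure.restrict_univ] at hFξ
  have hl : LocallyIntegrable fun t => S.coeff (F t) ξ := hFξ.locallyIntegrable (by norm_num)
  have he : ∀ ε ∈ Ioc (0 : ℝ) 1,
      (fun t => S.coeff (fε ε t) ξ) = mollify ψ (r ε) fun τ => S.coeff (F τ) ξ :=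
    fun ε hε => funext fun t => hmol ε hε t (S.eigTest ξ)
  refine ⟨fun ε hε => ⟨?_, ?_⟩, ?_⟩
  · rw [he ε hε]; exact hψ.continuous_mollify (hr.1 ε hε) hl
  · have h1 := hψ.lintegral_enorm_mollify_sq_le (hr.1 ε hε) hFξ.1
    rwa [← he ε hε] at h1
  · exact tendsto_setLIntegral_enorm_sub_of_mollify (gε := fun ε t => S.coeff (fε ε t) ξ) hl
      (hFf.mono fun t ht => by simp only [ht]) hψ hr he

theorem one_add_eig_rpow_one_add (s : ℝ) (ξ : S.Freq) :
    (1 + S.eig ξ) ^ (1 + s) = (1 + S.eig ξ) * (1 + S.eig ξ) ^ s := by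
  rw [Real.rpow_add (S.one_add_eig_pos ξ), Real.rpow_one]

/-- Energy bound for the modes of the very weak solution, uniform in the regularisation parameter
and summable over the modes. -/
theorem IsVeryWeakSolution.exists_mode_bound {T : ℝ} (hT : 0 < T) {s : ℝ} {a q : ℝ → ℝ}
    {f : ℝ → S.Distr} {u₀ u₁ : S.Distr} {aε qε : ℝ → ℝ → ℝ} {fε uε : ℝ → ℝ → S.Distr}
    (h : S.IsVeryWeakSolution T s a q f u₀ u₁ aε qε fε uε) (ha : MemLInftyOne T a) {a₀ : ℝ}
    (ha₀ : 0 < a₀) (ha_ge : ∀ t ∈ Icc 0 T, a₀ ≤ a t) (hu₀ : S.MemSob (1 + s) u₀)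
    (hu₁ : S.MemSob s u₁) :
    ∃ D : S.Freq → ℝ≥0∞, ∑' ξ, D ξ ≠ ∞ ∧ ∀ᶠ ε in 𝓝[>] (0 : ℝ), ∀ ξ, ∀ t ∈ Icc 0 T,
      ENNReal.ofReal ((1 + S.eig ξ) ^ (1 + s) * ‖S.coeff (uε ε t) ξ‖ ^ 2) ≤ D ξ := by
  obtain ⟨c, hc, hc1, M, A, hM, hbd⟩ := h.reg_a.exists_bounds hT ha ha₀ ha_ge
  obtain ⟨Q, hQ, hqbd⟩ := h.reg_q.exists_bounds
  obtain ⟨N, hN, hfbd⟩ := IsSourceRegularisation.exists_mode S h.reg_f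
  -- The factor `M + 1` comes from `λ M + 1 ≤ (M + 1)(1 + λ)`; it also covers the terms with `u₁`
  -- and `f`.
  let C : ℝ := Real.exp ((2 + Q) * T + A / c) / c * (M + 1)
  have hC : 0 ≤ C := by positivity
  refine ⟨fun ξ => ENNReal.ofReal C * (ENNReal.ofReal ((1 + S.eig ξ) ^ s * ‖S.coeff u₁ ξ‖ ^ 2) +
    ENNReal.ofReal ((1 + S.eig ξ) ^ (1 + s) * ‖S.coeff u₀ ξ‖ ^ 2) +
    ENNReal.ofReal ((1 + S.eig ξ) ^ s) * N ξ), ?_, ?_⟩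
  · rw [ENNReal.tsum_mul_left, ENNReal.tsum_add, ENNReal.tsum_add]
    exact ENNReal.mul_ne_top ENNReal.ofReal_ne_top (ENNReal.add_ne_top.2
      ⟨ENNReal.add_ne_top.2 ⟨(MemSob.tsum_lt_top S hu₁).ne, (MemSob.tsum_lt_top S hu₀).ne⟩, hN⟩)
  · filter_upwards [hbd, Ioc_mem_nhdsGT (one_pos (α := ℝ))] with ε hε hε1 ξ t ht
    obtain ⟨hca, haM, α', hα, hα', hA⟩ := hε
    obtain ⟨hqQ, hqc⟩ := hqbd ε hε1
    obtain ⟨hfc, hfN⟩ := (hfbd ξ).1 ε hε1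
    obtain ⟨v', hsol⟩ := SolvesCauchy.isModeSolution S (h.solves ε hε1) ξ
    have hE := hsol.energy_le (S.eig_nonneg ξ) hc hc1 hQ hα hα' hqc hfc hqQ hca
      ((le_abs_self _).trans (haM 0)) hA ht
    set w := (1 + S.eig ξ) ^ s with hw
    have hw0 : 0 ≤ w := Real.rpow_nonneg (S.one_add_eig_pos ξ).le s
    set I := ∫ τ in (0 : ℝ)..T, ‖S.coeff (fε ε τ) ξ‖ ^ 2 with hI
    have hI0 : 0 ≤ I := intervalIntegral.integral_nonneg hT.le fun x _ => by positivity
    have hIN : ENNReal.ofReal I ≤ N ξ := by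
      rw [hI, intervalIntegral.integral_of_le hT.le, ofReal_integral_eq_lintegral_ofReal
        ((show Continuous fun τ => ‖S.coeff (fε ε τ) ξ‖ ^ 2 by fun_prop).integrableOn_Ioc)
        (Eventually.of_forall fun _ => by positivity)]
      refine (setLIntegral_le_lintegral _ _).trans (le_trans (le_of_eq ?_) hfN)
      refine lintegral_congr fun τ => ?_
      rw [ENNReal.ofReal_pow (norm_nonneg _), ofReal_norm]
      norm_cast
    have hl := S.eig_nonneg ξ
    rw [S.one_add_eig_rpow_one_add, ← hw]
    have hmain : (1 + S.eig ξ) * w * ‖S.coeff (uε ε t) ξ‖ ^ 2 ≤ C * (w * ‖S.coeff u₁ ξ‖ ^ 2 +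
        (1 + S.eig ξ) * w * ‖S.coeff u₀ ξ‖ ^ 2 + w * I) := by
      set K := Real.exp ((2 + Q) * T + A / c)
      have hK : 0 ≤ K := (Real.exp_pos _).le
      have h1 : (1 + S.eig ξ) * ‖S.coeff (uε ε t) ξ‖ ^ 2 ≤ K / c *
          (‖S.coeff u₁ ξ‖ ^ 2 + (S.eig ξ * M + 1) * ‖S.coeff u₀ ξ‖ ^ 2 + I) := by
        rw [div_mul_eq_mul_div, le_div_iff₀ hc]
        linarith
      have h2 : ‖S.coeff u₁ ξ‖ ^ 2 + (S.eig ξ * M + 1) * ‖S.coeff u₀ ξ‖ ^ 2 + I ≤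
          (M + 1) * (‖S.coeff u₁ ξ‖ ^ 2 + (1 + S.eig ξ) * ‖S.coeff u₀ ξ‖ ^ 2 + I) := by
        have e1 : 0 ≤ M * ‖S.coeff u₁ ξ‖ ^ 2 := by positivity
        have e2 : 0 ≤ M * I := by positivity
        have e3 : 0 ≤ (M + S.eig ξ) * ‖S.coeff u₀ ξ‖ ^ 2 := by positivity
        linarith
      have h3 := mul_le_mul_of_nonneg_left
        (h1.trans (mul_le_mul_of_nonneg_left h2 (div_nonneg hK hc.le))) hw0
      simp only [C]
      linarith
    refine (ENNReal.ofReal_le_ofReal hmain).trans ?_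
    rw [ENNReal.ofReal_mul hC, ENNReal.ofReal_add (by positivity) (by positivity),
      ENNReal.ofReal_add (by positivity) (by positivity), ENNReal.ofReal_mul hw0 (q := I)]
    gcongr

/-- Each mode of the very weak solution converges uniformly on `[0,T]`. -/
theorem IsVeryWeakSolution.exists_tendsto_mode {T : ℝ} (hT : 0 < T) {s : ℝ} {a q : ℝ → ℝ}
    {f : ℝ → S.Distr} {u₀ u₁ : S.Distr} {aε qε : ℝ → ℝ → ℝ} {fε uε : ℝ → ℝ → S.Distr}
    (h : S.IsVeryWeakSolution T s a q f u₀ u₁ aε qε fε uε) (ha : MemLInftyOne T a) {a₀ : ℝ}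
    (ha₀ : 0 < a₀) (ha_ge : ∀ t ∈ Icc 0 T, a₀ ≤ a t) (hq : MemLp q ∞ (volume.restrict (Icc 0 T)))
    {u : ℝ → S.Distr} (hu : S.SolvesCauchy T a q f u₀ u₁ u) (ξ : S.Freq) :
    ∃ Ω : ℝ → ℝ, Tendsto Ω (𝓝[>] 0) (𝓝 0) ∧ ∀ᶠ ε in 𝓝[>] (0 : ℝ), ∀ t ∈ Icc 0 T,
      ‖S.coeff (uε ε t) ξ - S.coeff (u t) ξ‖ ≤ Ω ε := by
  obtain ⟨c, hc, hc1, M, A, hM, hbd⟩ := h.reg_a.exists_bounds hT ha ha₀ ha_ge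
  obtain ⟨Q, hQ, hqbd⟩ := h.reg_q.exists_bounds
  obtain ⟨N, hN, hfbd⟩ := IsSourceRegularisation.exists_mode S h.reg_f
  obtain ⟨v', hv⟩ := SolvesCauchy.isModeSolution S hu ξ
  obtain ⟨V, hV⟩ := isCompact_Icc.exists_bound_of_continuousOn hv.continuousOn
  have hV0 : 0 ≤ V := (norm_nonneg _).trans (hV 0 (left_mem_Icc.2 hT.le))
  have hac : ContinuousOn a (Icc 0 T) := ha.choose_spec.continuousOn
  have hta : Tendsto (fun ε => ∫⁻ t in Icc 0 T, ‖aε ε t - a t‖ₑ) (𝓝[>] 0) (𝓝 0) := by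
    obtain ⟨B, ψ, r, hB, hBa, -, -, hψ, hr, hmol, -⟩ := h.reg_a
    exact tendsto_setLIntegral_enorm_sub_of_mollify (hB.locallyIntegrable le_top) hBa hψ hr hmol
  have htq : Tendsto (fun ε => ∫⁻ t in Icc 0 T, ‖qε ε t - q t‖ₑ) (𝓝[>] 0) (𝓝 0) := by
    obtain ⟨B, ψ, r, hB, hBq, hψ, hr, hmol, -⟩ := h.reg_q
    exact tendsto_setLIntegral_enorm_sub_of_mollify (hB.locallyIntegrable le_top) hBq hψ hr hmol
  let X : ℝ → ℝ≥0∞ := fun ε => (∫⁻ t in Icc 0 T, ‖S.coeff (fε ε t) ξ - S.coeff (f t) ξ‖ₑ) +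
    ENNReal.ofReal (S.eig ξ * V) * (∫⁻ t in Icc 0 T, ‖aε ε t - a t‖ₑ) +
    ENNReal.ofReal V * (∫⁻ t in Icc 0 T, ‖qε ε t - q t‖ₑ)
  have hX : Tendsto X (𝓝[>] 0) (𝓝 0) := by
    have := ((hfbd ξ).2.add (ENNReal.Tendsto.const_mul hta
      (Or.inr (ENNReal.ofReal_ne_top (r := S.eig ξ * V))))).add
      (ENNReal.Tendsto.const_mul htq (Or.inr (ENNReal.ofReal_ne_top (r := V))))
    simpa using this
  -- This constant grows with the eigenvalue, so the convergence obtained is for each `ξ`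
  -- separately.
  let P : ℝ := S.eig ξ * M + Q
  have hXr : Tendsto (fun ε => (X ε).toReal) (𝓝[>] 0) (𝓝 0) := by
    simpa [Function.comp_def] using (ENNReal.tendsto_toReal ENNReal.zero_ne_top).comp hX
  refine ⟨fun ε => T * (X ε).toReal + T * P * gronwallBound 0 (T * P) (T * (X ε).toReal) T, ?_, ?_⟩
  · have hcont : Continuous fun δ : ℝ => T * δ + T * P * gronwallBound 0 (T * P) (T * δ) T :=
      (continuous_const.mul continuous_id).add (continuous_const.mul
        ((gronwallBound_continuous_ε 0 (T * P) T).comp (continuous_const.mul continuous_id)))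
    have h0 := (hcont.tendsto 0).comp hXr
    simpa [Function.comp_def, gronwallBound_ε0_δ0] using h0
  -- `toReal` sends `∞` to `0`, so the estimate is claimed only where `X ε` is finite, which holds
  -- for small `ε`.
  · filter_upwards [hbd, Ioc_mem_nhdsGT (one_pos (α := ℝ)),
      hX.eventually (gt_mem_nhds ENNReal.zero_lt_top)] with ε hε hε1 hXε t ht
    obtain ⟨hca, haM, α', hα, hα', hA⟩ := hε
    obtain ⟨hqQ, hqc⟩ := hqbd ε hε1
    obtain ⟨w', hw⟩ := SolvesCauchy.isModeSolution S (h.solves ε hε1) ξ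
    have haεc : Continuous (aε ε) := continuous_iff_continuousAt.2 fun t => (hα t).continuousAt
    exact hv.norm_sub_le hw (S.eig_nonneg ξ) hM hQ hV0 ENNReal.toReal_nonneg (fun t _ => haM t)
      (fun t _ => hqQ t) hV
      ((haεc.continuousOn.sub hac).aestronglyMeasurable measurableSet_Icc)
      (hqc.aestronglyMeasurable.sub hq.1) (ENNReal.ofReal_toReal hXε.ne).ge ht

end DiscreteSchrodinger

/-! ### Summation over the modes -/

theorem ENNReal.ofReal_mul_norm_sub_sq_le {E : Type*} [NormedAddCommGroup E] {w : ℝ} (hw : 0 ≤ w)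
    {x y : E} {D : ℝ≥0∞} (hx : ENNReal.ofReal (w * ‖x‖ ^ 2) ≤ D)
    (hy : ENNReal.ofReal (w * ‖y‖ ^ 2) ≤ D) : ENNReal.ofReal (w * ‖x - y‖ ^ 2) ≤ 4 * D := by
  have h1 : ‖x - y‖ ^ 2 ≤ 2 * ‖x‖ ^ 2 + 2 * ‖y‖ ^ 2 := by
    have := pow_le_pow_left₀ (norm_nonneg _) (norm_sub_le x y) 2
    nlinarith [sq_nonneg (‖x‖ - ‖y‖)]
  calc ENNReal.ofReal (w * ‖x - y‖ ^ 2)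
      ≤ ENNReal.ofReal (2 * (w * ‖x‖ ^ 2) + 2 * (w * ‖y‖ ^ 2)) :=
        ENNReal.ofReal_le_ofReal (by nlinarith)
    _ = 2 * ENNReal.ofReal (w * ‖x‖ ^ 2) + 2 * ENNReal.ofReal (w * ‖y‖ ^ 2) := by
        rw [ENNReal.ofReal_add (by positivity) (by positivity), ENNReal.ofReal_mul zero_le_two,
          ENNReal.ofReal_mul zero_le_two, ENNReal.ofReal_ofNat]
    _ ≤ 2 * D + 2 * D := by gcongr
    _ = 4 * D := by rw [← add_mul]; norm_num

/-- A sum is an integral for the counting measure; with the full σ-algebra on the index set every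
function is measurable, and dominated convergence applies. -/
theorem ENNReal.tendsto_tsum_of_dominated {ι : Type*} {α : Type*} {l : Filter α}
    [l.IsCountablyGenerated] {F : α → ι → ℝ≥0∞} {G D : ι → ℝ≥0∞} (hD : ∑' i, D i ≠ ∞)
    (hle : ∀ᶠ x in l, ∀ i, F x i ≤ D i) (hlim : ∀ i, Tendsto (fun x => F x i) l (𝓝 (G i))) :
    Tendsto (fun x => ∑' i, F x i) l (𝓝 (∑' i, G i)) := by
  let _ : MeasurableSpace ι := ⊤
  simp only [← lintegral_count] at hD ⊢
  exact tendsto_lintegral_filter_of_dominated_convergence D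
    (Eventually.of_forall fun _ => measurable_from_top)
    (hle.mono fun x hx => Eventually.of_forall hx) hD (Eventually.of_forall hlim)

theorem theorem2p7 {n : ℕ} (S : DiscreteSchrodinger n) {T : ℝ} (hT : 0 < T) (s : ℝ)
    (a q : ℝ → ℝ) (f : ℝ → S.Distr) (u₀ u₁ : S.Distr)
    (hf : S.MemL2Sob (Set.Icc 0 T) s f)
    (ha : MemLInftyOne T a) (a₀ : ℝ) (ha₀ : 0 < a₀) (ha_ge : ∀ t ∈ Set.Icc 0 T, a₀ ≤ a t)
    (hq : MeasureTheory.MemLp q ⊤ (MeasureTheory.volume.restrict (Set.Icc 0 T)))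
    (hu₀ : S.MemSob (1 + s) u₀) (hu₁ : S.MemSob s u₁)
    (u : ℝ → S.Distr) (hu : S.IsClassicalSolution T s a q f u₀ u₁ u)
    (aε qε : ℝ → ℝ → ℝ) (fε uε : ℝ → ℝ → S.Distr)
    (huε : S.IsVeryWeakSolution T s a q f u₀ u₁ aε qε fε uε) :
    Filter.Tendsto (fun ε => S.l2SobNorm (Set.Icc 0 T) (1 + s) (fun t => uε ε t - u t))
      (nhdsWithin 0 (Set.Ioi 0)) (nhds 0) := by
  have hsol := hu.2.2
  obtain ⟨D, hD, hbound⟩ := huε.exists_mode_bound S hT ha ha₀ ha_ge hu₀ hu₁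
  choose Ω hΩ hΩle using
    DiscreteSchrodinger.IsVeryWeakSolution.exists_tendsto_mode S hT huε ha ha₀ ha_ge hq hsol
  have hw : ∀ ξ, 0 ≤ (1 + S.eig ξ) ^ (1 + s) := fun ξ =>
    Real.rpow_nonneg (S.one_add_eig_pos ξ).le _
  have hcu : ∀ ξ, ContinuousOn (fun t => S.coeff (u t) ξ) (Icc 0 T) := fun ξ =>
    (DiscreteSchrodinger.SolvesCauchy.isModeSolution S hsol ξ).choose_spec.continuousOn
  -- the modes of the limit inherit the bound
  have hubound : ∀ ξ, ∀ t ∈ Icc 0 T,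
      ENNReal.ofReal ((1 + S.eig ξ) ^ (1 + s) * ‖S.coeff (u t) ξ‖ ^ 2) ≤ D ξ := fun ξ t ht => by
    have hlim : Tendsto (fun ε => S.coeff (uε ε t) ξ) (𝓝[>] 0) (𝓝 (S.coeff (u t) ξ)) := by
      rw [tendsto_iff_norm_sub_tendsto_zero]
      exact squeeze_zero' (Eventually.of_forall fun _ => norm_nonneg _)
        ((hΩle ξ).mono fun ε hε => hε t ht) (hΩ ξ)
    refine le_of_tendsto (ENNReal.tendsto_ofReal ((hlim.norm.pow 2).const_mul _))
      (hbound.mono fun ε hε => hε ξ t ht)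
  have hsq : Tendsto (fun ε => ∑' ξ, ENNReal.ofReal ((1 + S.eig ξ) ^ (1 + s)) *
      ∫⁻ t in Icc 0 T, ‖S.coeff (uε ε t - u t) ξ‖ₑ ^ (2 : ℝ)) (𝓝[>] 0) (𝓝 0) := by
    have hpull : ∀ ε ξ, ENNReal.ofReal ((1 + S.eig ξ) ^ (1 + s)) *
        ∫⁻ t in Icc 0 T, ‖S.coeff (uε ε t - u t) ξ‖ₑ ^ (2 : ℝ) = ∫⁻ t in Icc 0 T, ENNReal.ofReal
          ((1 + S.eig ξ) ^ (1 + s) * ‖S.coeff (uε ε t) ξ - S.coeff (u t) ξ‖ ^ 2) := fun ε ξ => by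
      rw [← lintegral_const_mul' _ _ ENNReal.ofReal_ne_top]
      simp only [S.ofReal_weight_mul, S.coeff_sub]
    simp only [hpull]
    rw [← tsum_zero (α := ℝ≥0∞) (β := S.Freq)]
    -- Both modes obey the bound `D ξ`, so their squared difference costs a factor `4`; the time
    -- integral adds the length `T`.
    refine ENNReal.tendsto_tsum_of_dominated (D := fun ξ => 4 * D ξ * ENNReal.ofReal T) ?_ ?_ ?_
    · rw [ENNReal.tsum_mul_right, ENNReal.tsum_mul_left]
      exact ENNReal.mul_ne_top (ENNReal.mul_ne_top (by norm_num) hD) ENNReal.ofReal_ne_top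
    · filter_upwards [hbound] with ε hε ξ
      refine (setLIntegral_mono' measurableSet_Icc fun t ht =>
        ENNReal.ofReal_mul_norm_sub_sq_le (hw ξ) (hε ξ t ht) (hubound ξ t ht)).trans_eq ?_
      rw [setLIntegral_const, Real.volume_Icc, sub_zero]
    · intro ξ
      have hlim : Tendsto (fun ε => ENNReal.ofReal ((1 + S.eig ξ) ^ (1 + s) * Ω ξ ε ^ 2) *
          ENNReal.ofReal T) (𝓝[>] 0) (𝓝 0) := by
        have h1 := ENNReal.tendsto_ofReal (((hΩ ξ).pow 2).const_mul ((1 + S.eig ξ) ^ (1 + s)))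
        simpa using ENNReal.Tendsto.mul_const h1 (Or.inr (ENNReal.ofReal_ne_top (r := T)))
      refine tendsto_of_tendsto_of_tendsto_of_le_of_le' tendsto_const_nhds hlim
        (Eventually.of_forall fun _ => zero_le) ((hΩle ξ).mono fun ε hε => ?_)
      refine (setLIntegral_mono' measurableSet_Icc fun t ht => ENNReal.ofReal_le_ofReal
        (mul_le_mul_of_nonneg_left (pow_le_pow_left₀ (norm_nonneg _) (hε t ht) 2)
          (hw ξ))).trans_eq ?_
      rw [setLIntegral_const, Real.volume_Icc, sub_zero]
  have hroot := ((ENNReal.continuous_rpow_const (y := (1 / 2 : ℝ))).tendsto 0).comp hsq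
  rw [ENNReal.zero_rpow_of_pos (by norm_num)] at hroot
  refine hroot.congr' ?_
  filter_upwards [Ioc_mem_nhdsGT (one_pos (α := ℝ))] with ε hε
  rw [Function.comp_apply, ← S.l2SobNorm_sq, ← ENNReal.rpow_mul]
  · norm_num
  -- The measurability required to write the norm as a sum follows from the continuity of both modes
  -- on `[0,T]`.
  · intro ξ
    simp only [S.coeff_sub]
    exact ((DiscreteSchrodinger.SolvesCauchy.isModeSolution S
      (huε.solves ε hε) ξ).choose_spec.continuousOn.sub (hcu ξ)).aestronglyMeasurable
        measurableSet_Icc
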